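/- **Setting.** Let $M$ be a smooth 3-manifold, $\varphi\colon M\to\mathbb R^4$ a smooth immersion and $\xi\colon M\to\mathbb R^4$ a smooth transversal field such that $D\xi$ is tangential. The Gauss and Weingarten formulas $D_XY=\nabla_XY+h(X,Y)\xi$, $D_X\xi=-SX$ define the induced connection $\nabla$, the affine metric $h$ and the shape operator $S$. Assume that $h$ is nondegenerate and that $\xi$ is (up to sign) the affine (Blaschke) normal, i.e. $\det(\varphi_*X_1,\varphi_*X_2,\varphi_*X_3,\xi)^2=|\det(h(X_i,X_j))|$ for all tangent vectors $X_1,X_2,X_3$ at a point. Let $\hat\nabla$ be the Levi-Civita connection of $h$, $\hat R$ its curvature tensor, $\widehat{\mathrm{Ric}}(X,Y)=\mathrm{trace}\{Z\mapsto\hat R(Z,X)Y\}$, $\hat\kappa=\frac16\sum_{i,j}h^{ij}\widehat{\mathrm{Ric}}_{ij}$ the normalized scalar curvature, $K(X,Y)=\nabla_XY-\hat\nabla_XY$ the difference tensor and $J=\frac16h(K,K)$ the Pick invariant. Then $M$ is an *indefinite affine hypersphere* if $h$ is indefinite and $S=H\,\mathrm{Id}$ for a constant $H\in\mathbb R$.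 For $p\in M$ let $SO(T_pM,h)$ be the group of linear isometries of $(T_pM,h)$ of determinant $1$. A *traceless cubic form* on $T_pM$ is given by a bilinear map $C\colon T_pM\times T_pM\to T_pM$ such that $h(C(X,Y),Z)$ is totally symmetric and $\mathrm{trace}\,C(X,\cdot)=0$ for all $X$; its stabilizer consists of the $L\in SO(T_pM,h)$ with $C(LX,LY)=L\,C(X,Y)$ for all $X,Y$. The hypersurface *admits a pointwise $\mathbb R$-symmetry* if for every $p\in M$ there is a subgroup $G_p\subset SO(T_pM,h)$ that is isomorphic to the additive group $\mathbb R$, that is the stabilizer of some traceless cubic form on $T_pM$, and whose elements $L$ all satisfy $K(LX,LY)=L\,K(X,Y)$ and $SL=LS$ at $p$. (In particular this holds if the stabilizer of $K$ itself at every point is isomorphic to $\mathbb R$.) **Theorem.** Let $M$ be a 3-dimensional indefinite affine hypersphere, with $S=H\,\mathrm{Id}$, that admits a pointwise $\mathbb R$-symmetry. Then $h$ has constant sectional curvature equal to $H$ (on all nondegenerate tangent planes), $\hat\kappa=H$, and the Pick invariant vanishes, $J=0$. -/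

import Mathlib

open scoped Manifold ContDiff

noncomputable section

namespace AffineGeometry

/-- The model space of a 3-dimensional manifold, also used as coordinate space. -/
abbrev E3 := EuclideanSpace ℝ (Fin 3)

/-- The ambient affine space. -/
abbrev E4 := EuclideanSpace ℝ (Fin 4)

/-! ### Pseudo-Riemannian geometry in a coordinate domain

`g : E3 → E3 →L[ℝ] E3 →L[ℝ] ℝ` is a field of symmetric nondegenerate bilinear forms. -/

section Metric

variable (g : E3 → E3 →L[ℝ] E3 →L[ℝ] ℝ) (x : E3)

/-- Christoffel symbols of the first kind, as a linear form in `Z`: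
`(X, Y, Z) ↦ (D_X g(Y,Z) + D_Y g(X,Z) - D_Z g(X,Y)) / 2`. -/
def christoffelFirst (X Y : E3) : E3 →L[ℝ] ℝ :=
  (1 / 2 : ℝ) • (fderiv ℝ g x X Y + fderiv ℝ g x Y X - ((fderiv ℝ g x).flip X).flip Y)

/-- Christoffel symbols of the Levi-Civita connection: the vector `W` with
`g(W, Z) = christoffelFirst g x X Y Z` for all `Z`. In coordinates
`∇̂_X Y = D_X Y + leviCivita g x X Y`. -/
def leviCivita (X Y : E3) : E3 :=
  (g x).inverse (christoffelFirst g x X Y)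

/-- The curvature tensor `R̂(X,Y)Z = ∇̂_X ∇̂_Y Z - ∇̂_Y ∇̂_X Z` (for vector fields with
constant coordinates `X, Y, Z`). -/
def riemann (X Y Z : E3) : E3 :=
  fderiv ℝ (fun y => leviCivita g y Y Z) x X - fderiv ℝ (fun y => leviCivita g y X Z) x Y
    + leviCivita g x X (leviCivita g x Y Z) - leviCivita g x Y (leviCivita g x X Z)

/-- The denominator of the sectional curvature; nonzero if and only if `X, Y` span a
nondegenerate plane (for symmetric nondegenerate `g x`). -/
def planeForm (X Y : E3) : ℝ := g x X X * g x Y Y - g x X Y ^ 2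

/-- The sectional curvature of the plane spanned by `X, Y`. -/
def sectionalCurvature (X Y : E3) : ℝ := g x (riemann g x X Y Y) X / planeForm g x X Y

/-- The coordinate basis. -/
def coordVec (i : Fin 3) : E3 := EuclideanSpace.single i 1

/-- The inverse `g^{ij}` of the Gram matrix in the coordinate basis. -/
def inverseMetric : Matrix (Fin 3) (Fin 3) ℝ :=
  (Matrix.of fun i j => g x (coordVec i) (coordVec j))⁻¹

/-- The Ricci tensor, `trace (Z ↦ R̂(Z,X)Y)`. -/
def ricci (X Y : E3) : ℝ := ∑ i, (riemann g x (coordVec i) X Y) i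

/-- The normalized scalar curvature `κ̂ = (1/(n(n-1))) ∑ g^{ij} Ric_{ij}`, here `n = 3`. -/
def scalarCurvature : ℝ :=
  (1 / 6 : ℝ) * ∑ i, ∑ j, inverseMetric g x i j * ricci g x (coordVec i) (coordVec j)

end Metric

/-! ### Equiaffine hypersurface theory in a coordinate domain

`f : E3 → E4` is a parametrized hypersurface and `ξ : E3 → E4` a vector field along it. -/

section Hypersurface

variable (f ξ : E3 → E4) (x : E3)

/-- `(X, a) ↦ df(X) + a ξ`, an isomorphism if `f` is an immersion and `ξ` is transverse. -/
def frameMap : E3 × ℝ →L[ℝ] E4 :=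
  (fderiv ℝ f x).coprod (ContinuousLinearMap.toSpanSingleton ℝ (ξ x))

/-- For `v = df(X) + a ξ`, the tangential part `X`. -/
def tangentialPart : E4 →L[ℝ] E3 :=
  (ContinuousLinearMap.fst ℝ E3 ℝ).comp (frameMap f ξ x).inverse

/-- For `v = df(X) + a ξ`, the transversal part `a`. -/
def transversalPart : E4 →L[ℝ] ℝ :=
  (ContinuousLinearMap.snd ℝ E3 ℝ).comp (frameMap f ξ x).inverse

/-- Christoffel symbols `Γ` of the induced connection `∇`, by the Gauss formula
`D²f(X,Y) = df(Γ(X,Y)) + h(X,Y) ξ`. In coordinates `∇_X Y = D_X Y + Γ(X,Y)`. -/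
def inducedConnection : E3 →L[ℝ] E3 →L[ℝ] E3 :=
  (ContinuousLinearMap.compL ℝ E3 E4 E3 (tangentialPart f ξ x)).comp
    (fderiv ℝ (fderiv ℝ f) x)

/-- The affine metric `h`, by the Gauss formula `D²f(X,Y) = df(Γ(X,Y)) + h(X,Y) ξ`. -/
def affineMetric : E3 →L[ℝ] E3 →L[ℝ] ℝ :=
  (ContinuousLinearMap.compL ℝ E3 E4 ℝ (transversalPart f ξ x)).comp
    (fderiv ℝ (fderiv ℝ f) x)

/-- The affine shape operator `S`, by the Weingarten formula `D_X ξ = -df(S X)`. -/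
def shapeOperator : E3 →L[ℝ] E3 :=
  -(tangentialPart f ξ x).comp (fderiv ℝ ξ x)

/-- The difference tensor `K(X,Y) = ∇_X Y - ∇̂_X Y`. -/
def differenceTensor (X Y : E3) : E3 :=
  inducedConnection f ξ x X Y - leviCivita (affineMetric f ξ) x X Y

/-- The Pick invariant `J = (1/(n(n-1))) h(K,K)`, here `n = 3`. -/
def pickInvariant : ℝ :=
  (1 / 6 : ℝ) * ∑ i, ∑ j, ∑ k, ∑ l,
    inverseMetric (affineMetric f ξ) x i j * inverseMetric (affineMetric f ξ) x k l *
      affineMetric f ξ x (differenceTensor f ξ x (coordVec i) (coordVec k))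
        (differenceTensor f ξ x (coordVec j) (coordVec l))

/-- The conditions that make `ξ` (up to sign) the affine (Blaschke) normal at a point of a
nondegenerate hypersurface. -/
structure IsBlaschkeNormalAt : Prop where
  /-- `ξ` is transverse -/
  transverse : ξ x ∉ Set.range (fderiv ℝ f x)
  /-- `Dξ` is tangential -/
  tangential : ∀ X, fderiv ℝ ξ x X ∈ Set.range (fderiv ℝ f x)
  /-- the affine metric is nondegenerate -/
  nondegenerate : ∀ X, (∀ Y, affineMetric f ξ x X Y = 0) → X = 0
  /-- `|θ| = ω_h`, where `θ(X₀,X₁,X₂) = det(df X₀, df X₁, df X₂, ξ)` and `ω_h = |det h|^{1/2}` -/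
  volume : ∀ X : Fin 3 → E3,
    (Matrix.of fun i j : Fin 4 =>
      (![fderiv ℝ f x (X 0), fderiv ℝ f x (X 1), fderiv ℝ f x (X 2), ξ x] i) j).det ^ 2
      = |(Matrix.of fun i j : Fin 3 => affineMetric f ξ x (X i) (X j)).det|

end Hypersurface

/-! ### Pointwise symmetry -/

/-- The special orthogonal group of a bilinear form on a tangent space. -/
def specialOrthogonal (h : E3 →L[ℝ] E3 →L[ℝ] ℝ) : Subgroup (E3 ≃ₗ[ℝ] E3) where
  carrier := {L | (∀ X Y, h (L X) (L Y) = h X Y) ∧ LinearEquiv.det L = 1}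
  one_mem' := ⟨fun _ _ => rfl, map_one _⟩
  mul_mem' := by
    rintro L L' ⟨h1, h2⟩ ⟨h1', h2'⟩
    exact ⟨fun X Y => by simp [h1, h1'], by rw [map_mul, h2, h2', mul_one]⟩
  inv_mem' := by
    rintro L ⟨h1, h2⟩
    refine ⟨fun X Y => ?_, by rw [map_inv, h2, inv_one]⟩
    have := h1 (L⁻¹ X) (L⁻¹ Y)
    simpa [← LinearEquiv.mul_apply] using this.symm

/-- The linear automorphisms of a tangent space that preserve a (1,2)-tensor `K`. -/
def tensorStabilizer (K : E3 → E3 → E3) : Subgroup (E3 ≃ₗ[ℝ] E3) where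
  carrier := {L | ∀ X Y, K (L X) (L Y) = L (K X Y)}
  one_mem' := fun _ _ => rfl
  mul_mem' := by
    intro L L' h1 h1' X Y
    simp only [LinearEquiv.mul_apply]
    rw [h1, h1']
  inv_mem' := by
    intro L h1 X Y
    apply L.injective
    have := h1 (L⁻¹ X) (L⁻¹ Y)
    simp only [← LinearEquiv.mul_apply, mul_inv_cancel, LinearEquiv.coe_one, id] at this ⊢
    exact this.symm

/-- A (1,2)-tensor `C` such that `h(C(X,Y),Z)` is totally symmetric and all `C(X,·)` are
traceless, i.e. (via `h`) a traceless cubic form. -/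
structure IsTracelessCubic (h : E3 →L[ℝ] E3 →L[ℝ] ℝ) (C : E3 →ₗ[ℝ] E3 →ₗ[ℝ] E3) : Prop where
  symm : ∀ X Y, C X Y = C Y X
  symm' : ∀ X Y Z, h (C X Y) Z = h (C X Z) Y
  trace : ∀ X, LinearMap.trace ℝ E3 (C X) = 0

/-- Symmetry under the group `G` at one point. The symmetry groups of type `G` are the groups of
isometries of determinant one that are isomorphic to `G` and occur as the full stabilizer of a
traceless cubic form `C`; one of them has to preserve, besides `h`, the difference tensor and the
shape operator. (It may be the full stabilizer of the difference tensor, or a smaller group.) -/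
def HasSymmetryAt (G : Type*) [Group G] (f ξ : E3 → E4) (x : E3) : Prop :=
  ∃ C : E3 →ₗ[ℝ] E3 →ₗ[ℝ] E3, IsTracelessCubic (affineMetric f ξ x) C ∧
    Nonempty (G ≃* ↥(specialOrthogonal (affineMetric f ξ x) ⊓
      tensorStabilizer fun X Y => C X Y)) ∧
    ∀ L ∈ specialOrthogonal (affineMetric f ξ x) ⊓ tensorStabilizer (fun X Y => C X Y),
      L ∈ tensorStabilizer (differenceTensor f ξ x) ∧
      ∀ X, shapeOperator f ξ x (L X) = L (shapeOperator f ξ x X)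

/-! ### Immersed hypersurfaces -/

section Global

variable {M : Type*} [TopologicalSpace M] [ChartedSpace E3 M]

/-- A coordinate independent property of `(φ, ξ)` holds at every point: it holds for the
coordinate expressions of `φ` and `ξ` in every chart, at every point of the chart. -/
def Everywhere (φ ξ : M → E4) (P : (E3 → E4) → (E3 → E4) → E3 → Prop) : Prop :=
  ∀ e ∈ IsManifold.maximalAtlas (𝓡 3) ∞ M, ∀ x ∈ e.target, P (φ ∘ e.symm) (ξ ∘ e.symm) x

/-- `φ` is an immersed nondegenerate hypersurface with affine (Blaschke) normal `ξ`. -/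
structure IsBlaschkeHypersurface (φ ξ : M → E4) : Prop where
  smooth : ContMDiff (𝓡 3) 𝓘(ℝ, E4) ∞ φ
  immersion : ∀ p, Function.Injective (mfderiv (𝓡 3) 𝓘(ℝ, E4) φ p)
  smooth_normal : ContMDiff (𝓡 3) 𝓘(ℝ, E4) ∞ ξ
  blaschke : Everywhere φ ξ IsBlaschkeNormalAt

/-- An affine hypersphere: the shape operator is `H` times the identity, with `H` constant. -/
structure IsAffineHypersphere (φ ξ : M → E4) (H : ℝ) : Prop extends
    IsBlaschkeHypersurface φ ξ where
  shape : Everywhere φ ξ fun f ξ x => ∀ X, shapeOperator f ξ x X = H • X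

/-- The affine metric is indefinite. -/
def IsIndefinite (φ ξ : M → E4) : Prop :=
  Everywhere φ ξ fun f ξ x =>
    (∃ X, 0 < affineMetric f ξ x X X) ∧ ∃ X, affineMetric f ξ x X X < 0

/-- The hypersurface admits a pointwise `G`-symmetry. -/
def AdmitsPointwiseSymmetry (G : Type*) [Group G] (φ ξ : M → E4) : Prop :=
  Everywhere φ ξ (HasSymmetryAt G)

/-- The affine metric has constant sectional curvature `c`. -/
def HasConstantSectionalCurvature (φ ξ : M → E4) (c : ℝ) : Prop :=
  Everywhere φ ξ fun f ξ x => ∀ X Y, planeForm (affineMetric f ξ) x X Y ≠ 0 →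
    sectionalCurvature (affineMetric f ξ) x X Y = c

end Global

end AffineGeometry

end

/-!
Let `L ≠ 1` belong to the symmetry group at a point, the stabilizer of a traceless cubic form `C`.
As `det L = 1` in dimension 3, `L` fixes a vector `v`. If `v` were not isotropic, `L` would be a
rotation about `v` of infinite order, hence `C` would be invariant under all rotations about `v`,
and the half turn about `v` would be an element of order two of the stabilizer, which is
torsion-free. So `v` is isotropic and `L` is a parabolic rotation; the only traceless cubic forms
invariant under `L` are the multiples of the cube of the covector `h(v, ·)`. Therefore
`K(X,Y) = c h(e,X) h(e,Y) e` with `h(e,e) = 0`, which gives `J = 0` and `K_X K_Y = 0`.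

The connections `∇̂ + K` and `∇̂ - K` are conjugate with respect to `h`, so the curvature of one is
minus the adjoint of that of the other, while their mean is `R̂(X,Y) + [K_X, K_Y]`. Since `∇` has
the curvature `R(X,Y)Z = H (h(Y,Z) X - h(X,Z) Y)` by the Gauss equation, so does `∇̂`.
-/

noncomputable section

namespace AffineGeometry

/-! ### Scalar products and dual frames -/

section ScalarProduct

variable {E : Type*} [NormedAddCommGroup E] [NormedSpace ℝ E]

/-- A scalar product of arbitrary signature. -/
structure IsScalarProduct (h : E →L[ℝ] E →L[ℝ] ℝ) : Prop where
  symm : ∀ X Y, h X Y = h Y X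
  nondegenerate : ∀ X, (∀ Y, h X Y = 0) → X = 0

/-- `b` is a basis (because of `card_eq`) and `d` is the dual basis with respect to `h`; traces,
determinants and coordinates in the basis `b` are computed by pairing with `d`. -/
structure IsDualFrame {ι : Type*} [Fintype ι] [DecidableEq ι] (h : E →L[ℝ] E →L[ℝ] ℝ)
    (b d : ι → E) : Prop where
  card_eq : Fintype.card ι = Module.finrank ℝ E
  pairing : ∀ i j, h (b i) (d j) = if i = j then 1 else 0

/-- A basis consisting of pairwise orthogonal nonisotropic vectors. -/
structure IsOrthogonalFrame {ι : Type*} [Fintype ι] (h : E →L[ℝ] E →L[ℝ] ℝ) (b : ι → E) :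
    Prop where
  card_eq : Fintype.card ι = Module.finrank ℝ E
  orthogonal : Pairwise fun i j => h (b i) (b j) = 0
  nonisotropic : ∀ i, h (b i) (b i) ≠ 0

variable {ι : Type*} [Fintype ι] {h : E →L[ℝ] E →L[ℝ] ℝ} {b d : ι → E}

namespace IsDualFrame

variable [DecidableEq ι]

theorem linearIndependent (hbd : IsDualFrame h b d) : LinearIndependent ℝ b :=
  .of_pairwise_dual_eq_zero_one b (fun j => (h.flip (d j)).toLinearMap)
    (fun i j hij => by simp [hbd.pairing, hij.symm]) fun i => by simp [hbd.pairing]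

/-- The basis underlying a dual frame. -/
def basis [Nonempty ι] (hbd : IsDualFrame h b d) : Module.Basis ι ℝ E :=
  basisOfLinearIndependentOfCardEqFinrank hbd.linearIndependent hbd.card_eq

variable [Nonempty ι]

@[simp] theorem basis_apply (hbd : IsDualFrame h b d) (i : ι) : hbd.basis i = b i := by
  simp [basis]

theorem repr_apply (hbd : IsDualFrame h b d) (u : E) (i : ι) :
    hbd.basis.repr u i = h u (d i) := by
  conv_rhs => rw [← hbd.basis.sum_repr u]
  simp [hbd.pairing, map_sum]

theorem sum_smul (hbd : IsDualFrame h b d) (u : E) : ∑ i, h u (d i) • b i = u := by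
  simpa [hbd.repr_apply] using hbd.basis.sum_repr u

theorem trace_eq (hbd : IsDualFrame h b d) (T : E →ₗ[ℝ] E) :
    LinearMap.trace ℝ E T = ∑ i, h (T (b i)) (d i) := by
  rw [LinearMap.trace_eq_matrix_trace ℝ hbd.basis]
  simp [Matrix.trace, LinearMap.toMatrix_apply, hbd.repr_apply]

theorem det_eq (hbd : IsDualFrame h b d) (T : E →ₗ[ℝ] E) :
    LinearMap.det T = (Matrix.of fun i j => h (T (b j)) (d i)).det := by
  rw [← LinearMap.det_toMatrix hbd.basis]
  congr 1
  ext i j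
  simp [LinearMap.toMatrix_apply, hbd.repr_apply]

end IsDualFrame

theorem IsOrthogonalFrame.isDualFrame [DecidableEq ι] (hb : IsOrthogonalFrame h b) :
    IsDualFrame h b fun i => (h (b i) (b i))⁻¹ • b i where
  card_eq := hb.card_eq
  pairing i j := by
    rcases eq_or_ne i j with rfl | hij
    · simp [hb.nonisotropic i]
    · simp [hij, hb.orthogonal hij]

theorem exists_common_orthogonal (h : E →L[ℝ] E →L[ℝ] ℝ) (b : ι → E)
    (hcard : Fintype.card ι < Module.finrank ℝ E) : ∃ z, z ≠ 0 ∧ ∀ i, h (b i) z = 0 := by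
  have : FiniteDimensional ℝ E := Module.finite_of_finrank_pos (by lia)
  have hker : LinearMap.ker (LinearMap.pi fun i => (h (b i)).toLinearMap) ≠ ⊥ :=
    LinearMap.ker_ne_bot_of_finrank_lt (by simpa using hcard)
  obtain ⟨z, hz, hz0⟩ := (Submodule.ne_bot_iff _).1 hker
  exact ⟨z, hz0, congrFun hz⟩

namespace IsScalarProduct

theorem nondegenerate_toBilinForm (hh : IsScalarProduct h) : h.toBilinForm.Nondegenerate :=
  ⟨fun X hX => hh.nondegenerate X hX, fun X hX => hh.nondegenerate X fun Y => by
    rw [hh.symm]; exact hX Y⟩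

theorem det_gram_ne_zero [DecidableEq ι] (hh : IsScalarProduct h) (b : Module.Basis ι ℝ E) :
    (Matrix.of fun i j => h (b i) (b j)).det ≠ 0 := by
  convert (LinearMap.BilinForm.nondegenerate_iff_det_ne_zero b).1 hh.nondegenerate_toBilinForm
    using 2
  ext i j
  simp [LinearMap.BilinForm.toMatrix_apply]

theorem exists_nonisotropic_orthogonal (hh : IsScalarProduct h)
    (hbo : Pairwise fun i j => h (b i) (b j) = 0) (hb : ∀ i, h (b i) (b i) ≠ 0)
    (hcard : Fintype.card ι < Module.finrank ℝ E) :
    ∃ z, (∀ i, h (b i) z = 0) ∧ h z z ≠ 0 := by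
  classical
  by_contra! hcon
  obtain ⟨z, hz0, hz⟩ := exists_common_orthogonal h b hcard
  refine hz0 (hh.nondegenerate z fun Y => ?_)
  let p : E := ∑ i, (h (b i) Y / h (b i) (b i)) • b i
  have hzp : h z p = 0 := by simp [p, map_sum, hh.symm z, hz]
  have hYp : ∀ i, h (b i) (Y - p) = 0 := fun i => by
    rw [map_sub, map_sum, Finset.sum_eq_single i (fun j _ hji => by simp [hbo hji.symm])
      (by simp)]
    simp [hb i]
  have hpolar := hcon (z + (Y - p)) fun i => by rw [map_add, hz, hYp, add_zero]
  rw [map_add, map_add, add_apply, add_apply, hcon z hz, hcon _ hYp, hh.symm (Y - p) z,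
    map_sub, hzp] at hpolar
  linarith

end IsScalarProduct

end ScalarProduct

theorem exists_fixed_vector {K V : Type*} [Field K] [NeZero (2 : K)] [AddCommGroup V]
    [Module K V] (hodd : Odd (Module.finrank K V)) {B : LinearMap.BilinForm K V}
    (hB : B.Nondegenerate) {L : V →ₗ[K] V} (hL : ∀ X Y, B (L X) (L Y) = B X Y)
    (hdet : LinearMap.det L = 1) : ∃ v, v ≠ 0 ∧ L v = v := by
  have : FiniteDimensional K V := Module.finite_of_finrank_pos hodd.pos
  let b := Module.finBasis K V
  have adjoint : B.comp L (L - 1) = B.comp ((-1 : K) • (L - 1)) 1 := by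
    ext X Y
    simp [hL]
  have hdetB := (LinearMap.BilinForm.nondegenerate_iff_det_ne_zero b).1 hB
  have gram := congrArg (fun Q => (LinearMap.BilinForm.toMatrix b Q).det) adjoint
  simp only [LinearMap.BilinForm.toMatrix_comp b b, Matrix.det_mul, Matrix.det_transpose,
    LinearMap.det_toMatrix, hdet, LinearMap.det_smul, hodd.neg_one_pow, map_one, one_mul,
    mul_one] at gram
  have hdet0 : LinearMap.det (L - 1) = 0 := by
    have : 2 * ((LinearMap.BilinForm.toMatrix b B).det * LinearMap.det (L - 1)) = 0 := by
      linear_combination gram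
    simpa [hdetB, two_ne_zero] using this
  obtain ⟨v, hv, hv0⟩ :=
    (Submodule.ne_bot_iff _).1 (LinearMap.bot_lt_ker_of_det_eq_zero hdet0).ne'
  exact ⟨v, hv0, sub_eq_zero.1 (by simpa using hv)⟩

section SpecialOrthogonal

variable {h : E3 →L[ℝ] E3 →L[ℝ] ℝ} {L : E3 ≃ₗ[ℝ] E3}

theorem det_eq_one_of_mem (hL : L ∈ specialOrthogonal h) :
    LinearMap.det (L : E3 →ₗ[ℝ] E3) = 1 := by
  rw [← LinearEquiv.coe_det, hL.2, Units.val_one]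

theorem IsScalarProduct.exists_fixed_vector (hh : IsScalarProduct h)
    (hL : L ∈ specialOrthogonal h) : ∃ v, v ≠ 0 ∧ L v = v :=
  AffineGeometry.exists_fixed_vector (by rw [finrank_euclideanSpace_fin]; decide)
    hh.nondegenerate_toBilinForm (L := L) hL.1 (det_eq_one_of_mem hL)

theorem IsScalarProduct.exists_orthogonalFrame (hh : IsScalarProduct h) {v : E3}
    (hv : h v v ≠ 0) : ∃ x y, IsOrthogonalFrame h ![v, x, y] := by
  obtain ⟨x, hvx, hx⟩ := hh.exists_nonisotropic_orthogonal (b := ![v])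
    (Subsingleton.pairwise) (by simpa using hv) (by simp)
  have hvx' : h v x = 0 := by simpa using hvx 0
  have hxv' : h x v = 0 := by rw [hh.symm, hvx']
  obtain ⟨y, hy, hyy⟩ := hh.exists_nonisotropic_orthogonal (b := ![v, x])
    (by intro i j hij; fin_cases i <;> fin_cases j <;> simp_all)
    (by intro i; fin_cases i <;> simpa) (by simp)
  have hvy : h v y = 0 := by simpa using hy 0
  have hxy : h x y = 0 := by simpa using hy 1
  have hyv : h y v = 0 := by rw [hh.symm, hvy]
  have hyx : h y x = 0 := by rw [hh.symm, hxy]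
  refine ⟨x, y, by simp, ?_, ?_⟩
  · intro i j hij
    fin_cases i <;> fin_cases j <;> simp_all
  · intro i
    fin_cases i <;> simpa

/-- A basis `e, w, f` with `e`, `f` isotropic, `h e f = 1` and `w` orthogonal to both. -/
structure IsNullFrame (h : E3 →L[ℝ] E3 →L[ℝ] ℝ) (e w f : E3) : Prop where
  isotropic_left : h e e = 0
  isotropic_right : h f f = 0
  pairing : h e f = 1
  orthogonal_left : h e w = 0
  orthogonal_right : h f w = 0
  nonisotropic : h w w ≠ 0

theorem IsNullFrame.isDualFrame (hh : IsScalarProduct h) {e w f : E3}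
    (hF : IsNullFrame h e w f) : IsDualFrame h ![e, w, f] ![f, (h w w)⁻¹ • w, e] := by
  obtain ⟨hee, hff, hef, hew, hfw, hww⟩ := hF
  refine ⟨by simp, fun i j => ?_⟩
  fin_cases i <;> fin_cases j <;> simp [hh.symm w e, hh.symm f e, hh.symm w f, *]

theorem IsScalarProduct.exists_nullFrame (hh : IsScalarProduct h) {e : E3} (he : e ≠ 0)
    (hee : h e e = 0) : ∃ w f, IsNullFrame h e w f := by
  obtain ⟨g, hg⟩ : ∃ g, h e g ≠ 0 := by
    by_contra! hcon
    exact he (hh.nondegenerate e hcon)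
  obtain ⟨g, hg⟩ : ∃ g, h e g = 1 := ⟨(h e g)⁻¹ • g, by simp [hg]⟩
  obtain ⟨f, hef, hff⟩ : ∃ f, h e f = 1 ∧ h f f = 0 := by
    refine ⟨g - (h g g / 2) • e, by simp [hg, hee], ?_⟩
    simp only [map_sub, map_smul, sub_apply, smul_apply, smul_eq_mul, hh.symm g e, hg, hee]
    ring
  have hfe : h f e = 1 := by rw [hh.symm, hef]
  obtain ⟨w, hw, hww⟩ := hh.exists_nonisotropic_orthogonal (b := ![e + f, e - f])
    (by intro i j hij; fin_cases i <;> fin_cases j <;> simp_all)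
    (by intro i; fin_cases i <;> norm_num [*]) (by simp)
  have hplus : h e w + h f w = 0 := by simpa using hw 0
  have hminus : h e w - h f w = 0 := by simpa using hw 1
  exact ⟨w, f, hee, hff, hef, by linarith, by linarith, hww⟩

end SpecialOrthogonal

/-! ### Isometries fixing a nonisotropic vector -/

section HalfTurn

variable {h : E3 →L[ℝ] E3 →L[ℝ] ℝ} {v : E3}

/-- The half turn about the line spanned by the vector `v` (for nonisotropic `v`). -/
def halfTurn (h : E3 →L[ℝ] E3 →L[ℝ] ℝ) (v : E3) : E3 →ₗ[ℝ] E3 :=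
  -LinearMap.transvection (h v).toLinearMap (-(2 / h v v) • v)

theorem halfTurn_apply (v X : E3) : halfTurn h v X = (h v X * (2 / h v v)) • v - X := by
  simp [halfTurn, LinearMap.transvection.apply, smul_smul, sub_eq_add_neg]

theorem halfTurn_self (hv : h v v ≠ 0) : halfTurn h v v = v := by
  rw [halfTurn_apply, mul_div_cancel₀ _ hv, two_smul, add_sub_cancel_right]

theorem halfTurn_of_orthogonal {X : E3} (hX : h v X = 0) : halfTurn h v X = -X := by
  simp [halfTurn_apply, hX]

theorem halfTurn_involutive (hv : h v v ≠ 0) : Function.Involutive (halfTurn h v) := by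
  intro X
  rw [halfTurn_apply v X, map_sub, map_smul, halfTurn_self hv, halfTurn_apply, sub_sub_cancel]

theorem det_halfTurn (hv : h v v ≠ 0) : LinearMap.det (halfTurn h v) = 1 := by
  rw [halfTurn, ← neg_one_smul ℝ, LinearMap.det_smul, LinearMap.transvection.det]
  simp only [finrank_euclideanSpace, Fintype.card_fin, neg_smul, ContinuousLinearMap.coe_coe,
    map_neg, map_smul, smul_eq_mul, div_mul_cancel₀ _ hv]
  norm_num

/-- The half turn about the line spanned by `v`, as a linear automorphism. -/
def halfTurnEquiv (hv : h v v ≠ 0) : E3 ≃ₗ[ℝ] E3 :=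
  .ofInvolutive (halfTurn h v) (halfTurn_involutive hv)

theorem halfTurnEquiv_sq (hv : h v v ≠ 0) : halfTurnEquiv hv ^ 2 = 1 :=
  LinearEquiv.ext fun X => halfTurn_involutive hv X

theorem halfTurnEquiv_ne_one (hv : h v v ≠ 0) : halfTurnEquiv hv ≠ 1 := by
  obtain ⟨z, hz0, hz⟩ := exists_common_orthogonal h ![v] (by simp)
  intro hcon
  have : halfTurn h v z = z := LinearEquiv.congr_fun hcon z
  rw [halfTurn_of_orthogonal (by simpa using hz 0)] at this
  exact hz0 (by linear_combination (norm := module) (-1 / 2 : ℝ) • this)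

theorem halfTurnEquiv_mem (hh : IsScalarProduct h) (hv : h v v ≠ 0) :
    halfTurnEquiv hv ∈ specialOrthogonal h := by
  refine ⟨fun X Y => ?_, Units.ext ?_⟩
  · change h (halfTurn h v X) (halfTurn h v Y) = h X Y
    simp only [halfTurn_apply, map_sub, map_smul, sub_apply, smul_apply, smul_eq_mul,
      hh.symm X v]
    field_simp
    ring
  · rw [LinearEquiv.coe_det]
    exact det_halfTurn hv

end HalfTurn

section NonisotropicFixedVector

variable {h : E3 →L[ℝ] E3 →L[ℝ] ℝ} {L : E3 ≃ₗ[ℝ] E3} {v x y : E3}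

theorem IsOrthogonalFrame.expand (hh : IsScalarProduct h)
    (hF : IsOrthogonalFrame h ![v, x, y]) (u : E3) :
    u = (h v u / h v v) • v + (h x u / h x x) • x + (h y u / h y y) • y := by
  conv_lhs => rw [← hF.isDualFrame.sum_smul u]
  simp [Fin.sum_univ_three, hh.symm u, div_eq_inv_mul]

theorem rotation_matrix_entries {a b p q r s : ℝ} (ha : a ≠ 0) (hnorm : a * p ^ 2 + b * q ^ 2 = a)
    (horth : a * p * r + b * q * s = 0) (hdet : p * s - q * r = 1) : r = -(b / a * q) ∧ s = p := by
  constructor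
  · field_simp
    linear_combination -r * hnorm + p * horth - b * q * hdet
  · apply mul_left_cancel₀ ha
    linear_combination -s * hnorm + q * horth + a * p * hdet

theorem exists_rotation_coefficients (hh : IsScalarProduct h)
    (hF : IsOrthogonalFrame h ![v, x, y]) (hL : L ∈ specialOrthogonal h) (hLv : L v = v) :
    ∃ p q, L x = p • x + q • y ∧ L y = -(h y y / h x x * q) • x + p • y ∧
      p ^ 2 + h y y / h x x * q ^ 2 = 1 := by
  have hx : h x x ≠ 0 := hF.nonisotropic 1
  have hy : h y y ≠ 0 := hF.nonisotropic 2
  have hv : h v v ≠ 0 := hF.nonisotropic 0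
  have hxy : h x y = 0 := hF.orthogonal (i := 1) (j := 2) (by decide)
  have hvx : h v x = 0 := hF.orthogonal (i := 0) (j := 1) (by decide)
  have hvy : h v y = 0 := hF.orthogonal (i := 0) (j := 2) (by decide)
  have perp : ∀ u, h v (L u) = h v u := fun u => by rw [← hL.1 v u, hLv]
  obtain ⟨p, q, hLx⟩ : ∃ p q, L x = p • x + q • y :=
    ⟨_, _, by simpa [perp, hvx] using hF.expand hh (L x)⟩
  obtain ⟨r, s, hLy⟩ : ∃ r s, L y = r • x + s • y :=
    ⟨_, _, by simpa [perp, hvy] using hF.expand hh (L y)⟩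
  have hyx : h y x = 0 := by rw [hh.symm, hxy]
  have norm_x : h x x * p ^ 2 + h y y * q ^ 2 = h x x := by
    have := hL.1 x x
    simp only [hLx, map_add, map_smul, add_apply, smul_apply, smul_eq_mul, hxy, mul_zero, add_zero,
      hyx, zero_add] at this
    linarith
  have inner_xy : h x x * p * r + h y y * q * s = 0 := by
    have := hL.1 x y
    simp only [hLx, map_add, map_smul, hLy, add_apply, smul_apply, smul_eq_mul, hxy, mul_zero,
      add_zero, hyx, zero_add] at this
    linarith
  have det_one : p * s - q * r = 1 := by
    have := det_eq_one_of_mem hL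
    rw [hF.isDualFrame.det_eq, Matrix.det_fin_three] at this
    simp only [LinearEquiv.coe_coe, map_smul, smul_eq_mul, Matrix.of_apply, Matrix.cons_val_zero,
      hLv, ne_eq, hv, not_false_eq_true, inv_mul_cancel₀, Matrix.cons_val_one, hLx, map_add,
      add_apply, smul_apply, hyx, mul_zero, add_zero, one_mul, Matrix.cons_val, hLy, hxy, zero_add,
      hh.symm x v, hvx, hh.symm y v, hvy, zero_mul, sub_zero] at this
    field_simp at this
    linarith
  obtain ⟨hr, hs⟩ := rotation_matrix_entries hx norm_x inner_xy det_one
  refine ⟨p, q, hLx, by rw [hLy, hs, hr], ?_⟩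
  field_simp
  linear_combination norm_x

theorem eq_one_of_fixes_orthogonal (hh : IsScalarProduct h) (hL : L ∈ specialOrthogonal h)
    (hv : h v v ≠ 0) (hLv : L v = v) {u : E3} (hu : u ≠ 0) (hvu : h v u = 0) (hLu : L u = u) :
    L = 1 := by
  obtain ⟨x, y, hF⟩ := hh.exists_orthogonalFrame hv
  obtain ⟨p, q, hLx, hLy, hpq⟩ := exists_rotation_coefficients hh hF hL hLv
  set γ := h y y / h x x
  have hx : h x x ≠ 0 := hF.nonisotropic 1
  have hy : h y y ≠ 0 := hF.nonisotropic 2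
  have hγ : γ ≠ 0 := div_ne_zero hy hx
  have hxy : h x y = 0 := hF.orthogonal (i := 1) (j := 2) (by decide)
  have hyx : h y x = 0 := by rw [hh.symm, hxy]
  obtain ⟨s, t, rfl⟩ : ∃ s t, u = s • x + t • y :=
    ⟨_, _, by simpa [hvu] using hF.expand hh u⟩
  have fixed_x : (p - 1) * s = γ * q * t := by
    have := congrArg (h x) hLu
    simp only [map_add, map_smul, hLx, smul_add, hLy, neg_smul, smul_neg, smul_eq_mul, hxy,
      mul_zero, add_zero, map_neg] at this
    apply mul_right_cancel₀ hx
    linarith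
  have fixed_y : (p - 1) * t = -(q * s) := by
    have := congrArg (h y) hLu
    simp only [map_add, map_smul, hLx, smul_add, hLy, neg_smul, smul_neg, hyx, smul_eq_mul,
      mul_zero, zero_add, map_neg, neg_zero] at this
    apply mul_right_cancel₀ hy
    linarith
  -- the determinant of `L - 1` on the plane orthogonal to `v`
  have hdet : (p - 1) ^ 2 + γ * q ^ 2 = 0 := by
    by_contra hne
    have hs : s = 0 := (mul_eq_zero.1 (by linear_combination (p - 1) * fixed_x + γ * q * fixed_y :
      ((p - 1) ^ 2 + γ * q ^ 2) * s = 0)).resolve_left hne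
    have ht : t = 0 := (mul_eq_zero.1 (by linear_combination (p - 1) * fixed_y - q * fixed_x :
      ((p - 1) ^ 2 + γ * q ^ 2) * t = 0)).resolve_left hne
    exact hu (by simp [hs, ht])
  obtain rfl : p = 1 := by linarith
  obtain rfl : q = 0 := by simpa [hγ] using hdet
  refine LinearEquiv.toLinearMap_injective (hF.isDualFrame.basis.ext fun i => ?_)
  fin_cases i <;> simp [hLv, hLx, hLy]

theorem eq_smul_of_fixed (hh : IsScalarProduct h) (hL : L ∈ specialOrthogonal h)
    (hL1 : L ≠ 1) (hv : h v v ≠ 0) (hLv : L v = v) {u : E3} (hLu : L u = u) :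
    u = (h v u / h v v) • v := by
  by_contra hne
  refine hL1 (eq_one_of_fixes_orthogonal hh hL hv hLv (sub_ne_zero.2 hne) ?_ ?_)
  · simp [hv]
  · rw [map_sub, map_smul, hLv, hLu]

variable {C : E3 →ₗ[ℝ] E3 →ₗ[ℝ] E3}

theorem apply_self_eq_smul (hh : IsScalarProduct h) (hL : L ∈ specialOrthogonal h)
    (hL1 : L ≠ 1) (hLC : L ∈ tensorStabilizer fun X Y => C X Y) (hv : h v v ≠ 0)
    (hLv : L v = v) : C v v = (h v (C v v) / h v v) • v :=
  eq_smul_of_fixed hh hL hL1 hv hLv (by simpa only [hLv] using (hLC v v).symm)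

theorem IsTracelessCubic.apply_orthogonal_trace
    (hC : IsTracelessCubic h C) (hF : IsOrthogonalFrame h ![v, x, y])
    (hCv : C v v = (h v (C v v) / h v v) • v) {u : E3} (hvu : h v u = 0) :
    h (C u y) y = -(h y y / h x x * h (C u x) x) := by
  have hCuv : h (C u v) v = 0 := by rw [hC.symm, hC.symm', hCv]; simp [hvu]
  have hx : h x x ≠ 0 := hF.nonisotropic 1
  have hy : h y y ≠ 0 := hF.nonisotropic 2
  have := hC.trace u
  rw [hF.isDualFrame.trace_eq, Fin.sum_univ_three] at this
  simp only [Matrix.cons_val_zero, map_smul, hCuv, smul_eq_mul, mul_zero, Matrix.cons_val_one,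
    zero_add, Matrix.cons_val] at this
  field_simp at this ⊢
  linear_combination this

theorem IsTracelessCubic.rotate_slot (hh : IsScalarProduct h) (hC : IsTracelessCubic h C)
    (hL : L ∈ specialOrthogonal h) (hv : h v v ≠ 0) (hLv : L v = v)
    (hCv : C v v = (h v (C v v) / h v v) • v) {u y z : E3} (hu : h v u = 0) (hy : h v y = 0)
    (hz : h v z = 0) : h (C u (L y)) z = h (C u y) (L z) := by
  obtain ⟨a, b, hF⟩ := hh.exists_orthogonalFrame hv
  obtain ⟨p, q, hLa, hLb, -⟩ := exists_rotation_coefficients hh hF hL hLv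
  have htr := hC.apply_orthogonal_trace hF hCv hu
  obtain ⟨s, t, rfl⟩ : ∃ s t, y = s • a + t • b :=
    ⟨_, _, by simpa [hy] using hF.expand hh y⟩
  obtain ⟨s', t', rfl⟩ : ∃ s t, z = s • a + t • b :=
    ⟨_, _, by simpa [hz] using hF.expand hh z⟩
  simp only [hLa, hLb, map_add, map_smul, add_apply, smul_apply, smul_eq_mul, htr,
    hC.symm' u b a]
  ring

theorem IsTracelessCubic.apply_orthogonal (hh : IsScalarProduct h) (hC : IsTracelessCubic h C)
    (hL : L ∈ specialOrthogonal h) (hL3 : L ^ 3 ≠ 1)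
    (hLC : L ∈ tensorStabilizer fun X Y => C X Y) (hv : h v v ≠ 0) (hLv : L v = v) {u y : E3}
    (hu : h v u = 0) (hy : h v y = 0) : C u y = (h v (C u y) / h v v) • v := by
  have hL1 : L ≠ 1 := by rintro rfl; simp at hL3
  have hCv := apply_self_eq_smul hh hL hL1 hLC hv hLv
  have perp : ∀ {z}, h v z = 0 → h v (L z) = 0 := fun hz => by rw [← hLv, hL.1, hz]
  have slide := fun {u y z} => hC.rotate_slot hh hL hv hLv hCv (u := u) (y := y) (z := z)
  have rotated : ∀ z, h v z = 0 → h (C u y) ((L ^ 3) z) = h (C u y) z := fun z hz =>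
    calc h (C u y) (L (L (L z)))
        = h (C (L u) (L y)) (L z) := by
          rw [← slide hu hy (perp (perp hz)), hC.symm, ← slide (perp hy) hu (perp hz), hC.symm]
      _ = h (C u y) z := by rw [show C (L u) (L y) = L (C u y) from hLC u y, hL.1]
  have hL3v : (L ^ 3) v = v := by change L (L (L v)) = v; simp only [hLv]
  have hL3mem : L ^ 3 ∈ specialOrthogonal h := pow_mem hL 3
  refine eq_smul_of_fixed hh hL3mem hL3 hv hL3v (sub_eq_zero.1 (hh.nondegenerate _ fun Z => ?_))
  obtain ⟨Z, rfl⟩ := (L ^ 3).surjective Z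
  have hZ := rotated (Z - (h v Z / h v v) • v) (by simp [hv])
  simp only [map_sub, map_smul, hL3v] at hZ
  rw [map_sub, sub_apply, hL3mem.1]
  linarith

theorem halfTurnEquiv_mem_tensorStabilizer (hh : IsScalarProduct h) (hC : IsTracelessCubic h C)
    (hL : L ∈ specialOrthogonal h) (hL3 : L ^ 3 ≠ 1)
    (hLC : L ∈ tensorStabilizer fun X Y => C X Y) (hv : h v v ≠ 0) (hLv : L v = v) :
    halfTurnEquiv hv ∈ tensorStabilizer fun X Y => C X Y := by
  intro X Y
  change C (halfTurn h v X) (halfTurn h v Y) = halfTurn h v (C X Y)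
  have hL1 : L ≠ 1 := by rintro rfl; simp at hL3
  have hCv := apply_self_eq_smul hh hL hL1 hLC hv hLv
  have hCperp := fun {u y} => hC.apply_orthogonal hh hL hL3 hLC hv hLv (u := u) (y := y)
  have hvC : ∀ {u}, h v u = 0 → h v (C v u) = 0 := fun {u} hu => by
    rw [hh.symm, hC.symm', hCv]; simp [hu]
  have hself : ∀ a : ℝ, halfTurn h v (a • v) = a • v := fun a => by
    rw [map_smul, halfTurn_self hv]
  have split : ∀ Z, ∃ a u, h v u = 0 ∧ Z = a • v + u := fun Z =>
    ⟨h v Z / h v v, Z - (h v Z / h v v) • v, by simp [hv], by abel⟩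
  obtain ⟨a, u, hu, rfl⟩ := split X
  obtain ⟨b, y, hy, rfl⟩ := split Y
  simp only [map_add, map_smul, LinearMap.add_apply, LinearMap.smul_apply, map_neg,
    LinearMap.neg_apply, halfTurn_self hv, halfTurn_of_orthogonal hu, halfTurn_of_orthogonal hy,
    hC.symm u v, halfTurn_of_orthogonal (hvC hu), halfTurn_of_orthogonal (hvC hy)]
  rw [hCv, hCperp hu hy, hself, hself]
  module

end NonisotropicFixedVector

/-! ### Parabolic rotations -/

section IsotropicFixedVector

variable {h : E3 →L[ℝ] E3 →L[ℝ] ℝ} {L : E3 ≃ₗ[ℝ] E3} {e w f : E3}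

/-- A null frame in which the isometry `L` has the normal form of a parabolic rotation. -/
structure IsParabolicFrame (h : E3 →L[ℝ] E3 →L[ℝ] ℝ) (L : E3 ≃ₗ[ℝ] E3) (e w f : E3) : Prop
    extends IsNullFrame h e w f where
  map_left : L e = e
  map_middle : L w = w + e
  map_right : L f = f - (h w w)⁻¹ • w - (2 * h w w)⁻¹ • e

theorem IsNullFrame.flipped_pairings (hh : IsScalarProduct h) (hF : IsNullFrame h e w f) :
    h w e = 0 ∧ h w f = 0 ∧ h f e = 1 := by
  simp [hh.symm w, hh.symm f e, hF.orthogonal_left, hF.orthogonal_right, hF.pairing]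

theorem IsNullFrame.expand (hh : IsScalarProduct h) (hF : IsNullFrame h e w f) (u : E3) :
    u = h e u • f + (h w u / h w w) • w + h f u • e := by
  conv_lhs => rw [← (hF.isDualFrame hh).sum_smul u]
  simp only [Fin.sum_univ_three, Matrix.cons_val, hh.symm u, map_smul, smul_apply, smul_eq_mul]
  module

theorem IsNullFrame.exists_parabolic_coefficients (hh : IsScalarProduct h)
    (hF : IsNullFrame h e w f) (hL : L ∈ specialOrthogonal h) (hLe : L e = e) :
    ∃ t : ℝ, L w = w + t • e ∧ L f = f - (t / h w w) • w - (t ^ 2 / (2 * h w w)) • e := by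
  obtain ⟨hee, hff, hef, hew, hfw, hww⟩ := id hF
  obtain ⟨hwe, hwf, hfe⟩ := hF.flipped_pairings hh
  have pair : ∀ u, h e (L u) = h e u := fun u => by rw [← hL.1 e u, hLe]
  obtain ⟨s, t, hLw⟩ : ∃ s t : ℝ, L w = s • w + t • e :=
    ⟨_, _, by simpa [pair, hew] using hF.expand hh (L w)⟩
  obtain ⟨a, b, hLf⟩ : ∃ a b : ℝ, L f = f + a • w + b • e :=
    ⟨_, _, by simpa [pair, hef] using hF.expand hh (L f)⟩
  obtain rfl : s = 1 := by
    have := det_eq_one_of_mem hL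
    rw [(hF.isDualFrame hh).det_eq, Matrix.det_fin_three] at this
    simp only [LinearEquiv.coe_coe, Matrix.of_apply, Matrix.cons_val_zero, Matrix.cons_val_one,
      map_add, map_smul, add_apply, smul_apply, smul_eq_mul, mul_zero, add_zero, one_mul,
      Matrix.cons_val, mul_one, zero_add, sub_zero, hLe, hef, hLw, hew, hLf, hfe, hwe, hee, hfw,
      hwf, hff] at this
    field_simp at this
    exact this
  have inner_wf : a * h w w + t = 0 := by
    simpa [hLw, hLf, *] using hL.1 w f
  have norm_f : 2 * b + a ^ 2 * h w w = 0 := by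
    have := hL.1 f f
    simp only [map_add, map_smul, add_apply, smul_eq_mul, mul_zero, add_zero, mul_one, zero_add,
      smul_apply, hLf, hff, hfw, hfe, hwf, hwe, hef, hew, hee] at this
    linarith
  obtain rfl : a = -(t / h w w) := by
    field_simp
    linarith
  obtain rfl : b = -(t ^ 2 / (2 * h w w)) := by
    field_simp at norm_f ⊢
    linarith
  exact ⟨t, by simpa using hLw, by rw [hLf]; module⟩

theorem exists_parabolicFrame (hh : IsScalarProduct h) (hL : L ∈ specialOrthogonal h)
    (hL1 : L ≠ 1) (he : e ≠ 0) (hee : h e e = 0) (hLe : L e = e) :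
    ∃ e w f, IsParabolicFrame h L e w f := by
  obtain ⟨w, f, hF⟩ := hh.exists_nullFrame he hee
  obtain ⟨t, hLw, hLf⟩ := hF.exists_parabolic_coefficients hh hL hLe
  have ht : t ≠ 0 := by
    rintro rfl
    refine hL1 (LinearEquiv.toLinearMap_injective ((hF.isDualFrame hh).basis.ext fun i => ?_))
    fin_cases i <;> simp [hLe, hLw, hLf]
  obtain ⟨-, hff, hef, hew, hfw, hww⟩ := hF
  refine ⟨t • e, w, t⁻¹ • f, ⟨by simp [hee], by simp [hff], by simp [hef, ht], by simp [hew],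
    by simp [hfw], hww⟩, by rw [map_smul, hLe], hLw, ?_⟩
  rw [map_smul, hLf]
  match_scalars <;> field_simp

namespace IsParabolicFrame

theorem eq_smul_of_fixed (hh : IsScalarProduct h) (hF : IsParabolicFrame h L e w f) {u : E3}
    (hu : L u = u) : u = h f u • e := by
  obtain ⟨⟨-, -, hef, hew, -, hww⟩, hLe, hLw, hLf⟩ := id hF
  have expand := hF.expand hh u
  set p := h f u
  set q := h w u / h w w
  set r := h e u
  rw [expand] at hu
  have hu' : q • e - r • ((h w w)⁻¹ • w + (2 * h w w)⁻¹ • e) = 0 := by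
    rw [← sub_eq_zero] at hu
    rw [← hu]
    simp only [map_add, map_smul, hLe, hLw, hLf]
    module
  have hr : r = 0 := by
    simpa [hh.symm w e, hew, hww] using congrArg (h w) hu'
  have hq : q = 0 := by
    simpa [hr, hh.symm f e, hef] using congrArg (h f) hu'
  rw [expand, hq, hr]
  simp

theorem exists_eq_smul_add_smul (hh : IsScalarProduct h) (hF : IsParabolicFrame h L e w f)
    {u : E3} {a : ℝ} (hu : L u = u + a • e) : ∃ b : ℝ, u = a • w + b • e := by
  have hfix : L (u - a • w) = u - a • w := by
    rw [map_sub, map_smul, hu, hF.map_middle]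
    module
  exact ⟨_, by rw [← hF.eq_smul_of_fixed hh hfix]; abel⟩

theorem trace_eq (hh : IsScalarProduct h) (hF : IsParabolicFrame h L e w f) (A : E3 →ₗ[ℝ] E3) :
    LinearMap.trace ℝ E3 A = h (A e) f + (h w w)⁻¹ * h (A w) w + h (A f) e := by
  simp [(hF.isDualFrame hh).trace_eq, Fin.sum_univ_three]

theorem apply_of_commute (hh : IsScalarProduct h) (hF : IsParabolicFrame h L e w f)
    {A : E3 →ₗ[ℝ] E3} (hA : ∀ X Y, h (A X) Y = h (A Y) X) (htr : LinearMap.trace ℝ E3 A = 0)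
    (hcomm : ∀ X, A (L X) = L (A X)) : A e = 0 ∧ A w = 0 ∧ ∃ ν : ℝ, A f = ν • e := by
  obtain ⟨⟨hee, hff, hef, hew, hfw, hww⟩, hLe, hLw, hLf⟩ := id hF
  obtain ⟨hwe, hwf, hfe⟩ := hF.flipped_pairings hh
  obtain ⟨α, hAe⟩ : ∃ α : ℝ, A e = α • e := ⟨_, hF.eq_smul_of_fixed hh (by rw [← hcomm, hLe])⟩
  obtain ⟨β, hAw⟩ : ∃ β : ℝ, A w = α • w + β • e := by
    refine hF.exists_eq_smul_add_smul hh ?_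
    rw [← hcomm, hLw, map_add, hAe]
  obtain ⟨ν, hAf⟩ : ∃ ν : ℝ, A f = α • f - (β / h w w) • w + ν • e := by
    have hfix : L (A f - α • f + (β / h w w) • w) = A f - α • f + (β / h w w) • w := by
      rw [map_add, map_sub, ← hcomm, map_smul, map_smul, hLw, hLf, map_sub, map_sub, map_smul,
        map_smul, hAw, hAe]
      module
    exact ⟨_, by rw [← hF.eq_smul_of_fixed hh hfix]; abel⟩
  obtain rfl : β = 0 := by
    have := hA w f
    simp only [map_add, map_smul, add_apply, smul_apply, smul_eq_mul, mul_zero, mul_one, zero_add,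
      map_sub, sub_apply, zero_sub, add_zero, hAw, hwf, hef, hAf, hfw, hew] at this
    field_simp at this
    linarith
  obtain rfl : α = 0 := by
    rw [hF.trace_eq hh] at htr
    simp only [map_smul, smul_apply, smul_eq_mul, mul_one, zero_smul, add_zero, zero_div, sub_zero,
      map_add, add_apply, mul_zero, hAe, hef, hAw, hAf, hfe, hee] at htr
    field_simp at htr
    linarith
  exact ⟨by simpa using hAe, by simpa using hAw, ν, by simpa using hAf⟩

theorem apply_left_middle (hh : IsScalarProduct h) (hF : IsParabolicFrame h L e w f)
    {C : E3 →ₗ[ℝ] E3 →ₗ[ℝ] E3} (hC : IsTracelessCubic h C)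
    (hLC : L ∈ tensorStabilizer fun X Y => C X Y) :
    C e e = 0 ∧ C e w = 0 ∧ C e f = 0 ∧ C w w = 0 ∧ ∃ σ : ℝ, C w f = σ • e := by
  obtain ⟨⟨-, -, hef, hew, -, hww⟩, hLe, hLw, hLf⟩ := id hF
  have equiv : ∀ X Y, L (C X Y) = C (L X) (L Y) := fun X Y => (hLC X Y).symm
  obtain ⟨Cee, Cew, ν, Cef⟩ := hF.apply_of_commute hh (hC.symm' e) (hC.trace e)
    fun X => by rw [equiv, hLe]
  obtain ⟨τ, Cww⟩ : ∃ τ : ℝ, C w w = τ • e := ⟨_, hF.eq_smul_of_fixed hh (by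
    simp [equiv, hLw, hC.symm w e, Cew, Cee])⟩
  obtain ⟨σ, Cwf⟩ : ∃ σ : ℝ, C w f = (ν - τ / h w w) • w + σ • e := by
    refine hF.exists_eq_smul_add_smul hh ?_
    simp only [equiv, hLw, hLf, map_add, map_sub, map_smul, LinearMap.add_apply, hC.symm w e,
      Cew, Cee, Cef, Cww]
    module
  have hτ : 2 * τ = ν * h w w := by
    have := hC.symm' w f w
    simp only [map_add, map_smul, add_apply, smul_apply, smul_eq_mul, mul_zero, add_zero, mul_one,
      Cwf, hew, Cww, hef] at this
    field_simp at this
    linarith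
  obtain rfl : ν = 0 := by
    have := hC.trace f
    rw [hF.trace_eq hh, hC.symm f e, Cef, hC.symm f w, Cwf, hC.symm' f f e, hC.symm f e,
      Cef] at this
    simp only [map_smul, smul_apply, smul_eq_mul, mul_one, map_add, add_apply, mul_zero, add_zero,
      hef, hew] at this
    field_simp at this
    exact mul_right_cancel₀ hww (by linarith)
  obtain rfl : τ = 0 := by linarith
  exact ⟨Cee, Cew, by simpa using Cef, by simpa using Cww, σ, by simpa using Cwf⟩

theorem apply_eq_smul (hh : IsScalarProduct h) (hF : IsParabolicFrame h L e w f)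
    {C : E3 →ₗ[ℝ] E3 →ₗ[ℝ] E3} (hC : IsTracelessCubic h C)
    (hLC : L ∈ tensorStabilizer fun X Y => C X Y) (X Y : E3) :
    C X Y = (h (C f f) f * h e X * h e Y) • e := by
  obtain ⟨⟨hee, -, hef, hew, -, hww⟩, -, -, hLf⟩ := id hF
  obtain ⟨Cee, Cew, Cef, Cww, σ, Cwf⟩ := hF.apply_left_middle hh hC hLC
  obtain ⟨κ, Cff⟩ : ∃ κ : ℝ, C f f = (-(2 * σ) / h w w) • w + κ • e := by
    refine hF.exists_eq_smul_add_smul hh ?_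
    rw [show L (C f f) = C (L f) (L f) from (hLC f f).symm]
    simp only [hLf, map_sub, map_smul, LinearMap.sub_apply, LinearMap.smul_apply,
      hC.symm f w, hC.symm f e, hC.symm w e, Cee, Cew, Cef, Cww, Cwf]
    module
  obtain rfl : σ = 0 := by
    have := hC.symm' f f w
    rw [hC.symm f w, Cwf, Cff] at this
    simp only [map_add, map_smul, add_apply, smul_apply, smul_eq_mul, mul_zero, add_zero, mul_one,
      hew, hef] at this
    field_simp at this
    linarith
  have hκ : h (C f f) f = κ := by simp [Cff, hef]
  rw [hκ, hF.expand hh X, hF.expand hh Y]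
  simp only [map_add, map_smul, LinearMap.add_apply, LinearMap.smul_apply, mul_zero, neg_zero,
    zero_div, zero_smul, zero_add, hC.symm f w, smul_zero, add_zero, hC.symm f e, hC.symm w e,
    smul_eq_mul, mul_one, Cff, Cwf, Cef, Cww, Cew, Cee, hef, hew, hee]
  module

end IsParabolicFrame

end IsotropicFixedVector

section Stabilizer

variable {h : E3 →L[ℝ] E3 →L[ℝ] ℝ} {C K : E3 →ₗ[ℝ] E3 →ₗ[ℝ] E3}

theorem exists_isotropic_fixed_vector (hh : IsScalarProduct h) (hC : IsTracelessCubic h C)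
    [Nontrivial ↥(specialOrthogonal h ⊓ tensorStabilizer fun X Y => C X Y)]
    [IsMulTorsionFree ↥(specialOrthogonal h ⊓ tensorStabilizer fun X Y => C X Y)] :
    ∃ L ∈ specialOrthogonal h ⊓ tensorStabilizer fun X Y => C X Y,
      L ≠ 1 ∧ ∃ e, e ≠ 0 ∧ h e e = 0 ∧ L e = e := by
  have torsion_free : ∀ L ∈ specialOrthogonal h ⊓ tensorStabilizer fun X Y => C X Y,
      ∀ n ≠ 0, L ^ n = 1 → L = 1 := fun L hL n hn hLn =>
    congrArg Subtype.val (pow_left_injective hn (by simpa [Subtype.ext_iff] using hLn) :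
      (⟨L, hL⟩ : ↥(specialOrthogonal h ⊓ tensorStabilizer fun X Y => C X Y)) = 1)
  obtain ⟨⟨L, hL⟩, hL1⟩ :=
    exists_ne (1 : ↥(specialOrthogonal h ⊓ tensorStabilizer fun X Y => C X Y))
  replace hL1 : L ≠ 1 := fun hcon => hL1 (Subtype.ext hcon)
  obtain ⟨v, hv0, hLv⟩ := hh.exists_fixed_vector hL.1
  refine ⟨L, hL, hL1, v, hv0, ?_, hLv⟩
  by_contra hv
  have hL3 : L ^ 3 ≠ 1 := fun hcon => hL1 (torsion_free L hL 3 (by decide) hcon)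
  exact halfTurnEquiv_ne_one hv (torsion_free _ ⟨halfTurnEquiv_mem hh hv,
    halfTurnEquiv_mem_tensorStabilizer hh hC hL.1 hL3 hL.2 hv hLv⟩ 2 (by decide)
    (halfTurnEquiv_sq hv))

theorem exists_isotropic_eq_smul (hh : IsScalarProduct h) (hC : IsTracelessCubic h C)
    [Nontrivial ↥(specialOrthogonal h ⊓ tensorStabilizer fun X Y => C X Y)]
    [IsMulTorsionFree ↥(specialOrthogonal h ⊓ tensorStabilizer fun X Y => C X Y)]
    (hK : IsTracelessCubic h K)
    (hCK : specialOrthogonal h ⊓ tensorStabilizer (fun X Y => C X Y) ≤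
      tensorStabilizer fun X Y => K X Y) :
    ∃ e c, h e e = 0 ∧ ∀ X Y, K X Y = (c * h e X * h e Y) • e := by
  obtain ⟨L, hL, hL1, e₀, he₀, hnull, hfix⟩ := exists_isotropic_fixed_vector hh hC
  obtain ⟨e, w, f, hF⟩ := exists_parabolicFrame hh hL.1 hL1 he₀ hnull hfix
  exact ⟨e, h (K f f) f, hF.isotropic_left, hF.apply_eq_smul hh hK (hCK hL)⟩

end Stabilizer

section Determinant

variable {n : Type*} [Fintype n] [DecidableEq n] {M : ℝ → Matrix n n ℝ} {M' N : Matrix n n ℝ}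
  {t : ℝ}

theorem hasDerivAt_det (hM : ∀ i j, HasDerivAt (fun s => M s i j) (M' i j) t) :
    HasDerivAt (fun s => (M s).det) ((M t).adjugate * M').trace t := by
  have leibniz : HasDerivAt (fun s => (M s).det)
      (∑ σ : Equiv.Perm n, ((Equiv.Perm.sign σ : ℤ) : ℝ) *
        ∑ i, (∏ j ∈ Finset.univ.erase i, M t (σ j) j) • M' (σ i) i) t := by
    simp only [Matrix.det_apply']
    refine HasDerivAt.fun_sum fun σ _ => HasDerivAt.const_mul _ ?_
    exact HasDerivAt.fun_finsetProd fun i _ => hM (σ i) i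
  have cramer : ∀ i, ((M t).adjugate * M') i i = ((M t).updateCol i fun k => M' k i).det := by
    intro i
    rw [← Matrix.cramer_apply, Matrix.cramer_eq_adjugate_mulVec]
    rfl
  convert leibniz using 1
  simp only [Matrix.trace, Matrix.diag_apply, cramer, Matrix.det_apply', Finset.mul_sum]
  rw [Finset.sum_comm]
  refine Finset.sum_congr rfl fun σ _ => Finset.sum_congr rfl fun i _ => ?_
  rw [← Finset.mul_prod_erase _ _ (Finset.mem_univ i), Matrix.updateCol_self, smul_eq_mul,
    mul_comm (M' _ _)]
  congr 2
  refine Finset.prod_congr rfl fun j hj => ?_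
  rw [Matrix.updateCol_ne (Finset.ne_of_mem_erase hj)]

theorem hasDerivAt_det_of_mul_left
    (hM : ∀ i j, HasDerivAt (fun s => M s i j) ((N * M t) i j) t) :
    HasDerivAt (fun s => (M s).det) (N.trace * (M t).det) t := by
  convert hasDerivAt_det hM using 1
  rw [Matrix.trace_mul_comm, Matrix.mul_assoc, Matrix.mul_adjugate, Matrix.mul_smul,
    Matrix.mul_one, Matrix.trace_smul, smul_eq_mul, mul_comm]

theorem hasDerivAt_det_of_congruence
    (hM : ∀ i j, HasDerivAt (fun s => M s i j) ((N * M t + M t * N.transpose) i j) t) :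
    HasDerivAt (fun s => (M s).det) (2 * N.trace * (M t).det) t := by
  convert hasDerivAt_det hM using 1
  rw [Matrix.mul_add, Matrix.trace_add, Matrix.trace_mul_comm, Matrix.mul_assoc,
    Matrix.mul_adjugate, ← Matrix.mul_assoc, Matrix.adjugate_mul, Matrix.mul_smul,
    Matrix.mul_one, Matrix.smul_mul, Matrix.one_mul, Matrix.trace_smul, Matrix.trace_smul,
    Matrix.trace_transpose, smul_eq_mul]
  ring

end Determinant

/-! ### Conjugate connections -/

section Connection

set_option maxSynthPendingDepth 6

variable {E F : Type*} [NormedAddCommGroup E] [NormedSpace ℝ E] [NormedAddCommGroup F]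
  [NormedSpace ℝ F]

theorem fderiv_apply_apply {A : E → E →L[ℝ] E →L[ℝ] F} {x : E} (hA : DifferentiableAt ℝ A x)
    (X Y Z : E) : fderiv ℝ (fun y => A y X Y) x Z = fderiv ℝ A x Z X Y := by
  rw [fderiv_clm_apply (by fun_prop) (by fun_prop), fderiv_clm_apply hA (by fun_prop)]
  simp

/-- The curvature tensor `R(W,X)Y` of the connection `∇_X Y = D_X Y + Γ(X,Y)` on an open subset of
a vector space. -/
def curvature (Γ : E → E →L[ℝ] E →L[ℝ] E) (x W X Y : E) : E :=
  fderiv ℝ Γ x W X Y - fderiv ℝ Γ x X W Y + Γ x W (Γ x X Y) - Γ x X (Γ x W Y)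

/-- The connections with Christoffel symbols `Γ` and `Γ'` are conjugate at `x`:
`X g(Y,Z) = g(∇_X Y, Z) + g(Y, ∇'_X Z)`. A connection conjugate to itself is metric. -/
def AreConjugateAt (g : E → E →L[ℝ] E →L[ℝ] ℝ) (Γ Γ' : E → E →L[ℝ] E →L[ℝ] E) (x : E) : Prop :=
  ∀ X Y Z, fderiv ℝ g x X Y Z = g x (Γ x X Y) Z + g x Y (Γ' x X Z)

variable {g : E → E →L[ℝ] E →L[ℝ] ℝ} {Γ Γ' A : E → E →L[ℝ] E →L[ℝ] E} {x : E}

theorem AreConjugateAt.fderiv_fderiv (hg : ContDiffAt ℝ 2 g x) (hΓ : DifferentiableAt ℝ Γ x)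
    (hΓ' : DifferentiableAt ℝ Γ' x) (hconj : ∀ᶠ y in nhds x, AreConjugateAt g Γ Γ' y)
    (W X Y Z : E) :
    fderiv ℝ (fderiv ℝ g) x W X Y Z
      = g x (fderiv ℝ Γ x W X Y + Γ x W (Γ x X Y)) Z + g x (Γ x X Y) (Γ' x W Z)
        + g x (Γ x W Y) (Γ' x X Z) + g x Y (fderiv ℝ Γ' x W X Z + Γ' x W (Γ' x X Z)) := by
  have dg : DifferentiableAt ℝ g x := hg.differentiableAt (by simp)
  have dDg : DifferentiableAt ℝ (fderiv ℝ g) x :=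
    (hg.fderiv_right (m := 1) (by norm_num)).differentiableAt (by simp)
  have dgY : DifferentiableAt ℝ (fun y => g y Y) x := by fun_prop
  have dDgX : DifferentiableAt ℝ (fun y => fderiv ℝ g y X) x := dDg.clm_apply (by fun_prop)
  have dΓXY : DifferentiableAt ℝ (fun y => Γ y X Y) x := by fun_prop
  have dΓXZ : DifferentiableAt ℝ (fun y => Γ' y X Z) x := by fun_prop
  have dgΓ : DifferentiableAt ℝ (fun y => g y (Γ y X Y)) x := dg.clm_apply dΓXY
  have compat : (fun y => fderiv ℝ g y X Y Z) =ᶠ[nhds x] fun y =>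
      g y (Γ y X Y) Z + g y Y (Γ' y X Z) := hconj.mono fun y hy => hy X Y Z
  have deriv := congrArg (fun B : E →L[ℝ] ℝ => B W) compat.fderiv_eq
  rw [fderiv_apply_apply dDgX, fderiv_clm_apply dDg (by fun_prop),
    fderiv_fun_add (by fun_prop) (dgY.clm_apply dΓXZ), fderiv_clm_apply dgΓ (by fun_prop),
    fderiv_clm_apply dgY dΓXZ, fderiv_clm_apply dg dΓXY, fderiv_clm_apply dg (by fun_prop)]
    at deriv
  simp only [fderiv_fun_const, Pi.zero_apply, ContinuousLinearMap.comp_zero, zero_add,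
    ContinuousLinearMap.flip_apply, ContinuousLinearMap.flip_add, add_apply,
    ContinuousLinearMap.comp_apply, fderiv_apply_apply hΓ, hconj.self_of_nhds W,
    fderiv_apply_apply hΓ'] at deriv
  rw [deriv]
  simp only [map_add, add_apply]
  ring

theorem AreConjugateAt.curvature_add_curvature_eq_zero (hg : ContDiffAt ℝ 2 g x)
    (hΓ : DifferentiableAt ℝ Γ x) (hΓ' : DifferentiableAt ℝ Γ' x)
    (hconj : ∀ᶠ y in nhds x, AreConjugateAt g Γ Γ' y) (W X Y Z : E) :
    g x (curvature Γ x W X Y) Z + g x Y (curvature Γ' x W X Z) = 0 := by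
  have symm : fderiv ℝ (fderiv ℝ g) x W X Y Z = fderiv ℝ (fderiv ℝ g) x X W Y Z := by
    rw [hg.isSymmSndFDerivAt (by simp) W X]
  rw [fderiv_fderiv hg hΓ hΓ' hconj, fderiv_fderiv hg hΓ hΓ' hconj] at symm
  simp only [curvature, map_add, map_sub, add_apply, sub_apply] at symm ⊢
  linear_combination symm

theorem curvature_add_add_curvature_sub (hΓ : DifferentiableAt ℝ Γ x)
    (hA : DifferentiableAt ℝ A x) (W X Y : E) :
    curvature (Γ + A) x W X Y + curvature (Γ - A) x W X Y
      = (2 : ℝ) • (curvature Γ x W X Y + (A x W (A x X Y) - A x X (A x W Y))) := by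
  have deriv_add : fderiv ℝ (Γ + A) x = fderiv ℝ Γ x + fderiv ℝ A x := fderiv_add hΓ hA
  have deriv_sub : fderiv ℝ (Γ - A) x = fderiv ℝ Γ x - fderiv ℝ A x := fderiv_sub hΓ hA
  simp only [curvature, deriv_add, deriv_sub, Pi.add_apply, Pi.sub_apply, add_apply, sub_apply,
    map_add, map_sub]
  module

end Connection

theorem IsScalarProduct.isInvertible {E : Type*} [NormedAddCommGroup E] [NormedSpace ℝ E]
    [FiniteDimensional ℝ E] {h : E →L[ℝ] E →L[ℝ] ℝ} (hh : IsScalarProduct h) :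
    h.IsInvertible := by
  have hinj : Function.Injective h := (injective_iff_map_eq_zero h).2 fun X hX =>
    hh.nondegenerate X fun Y => by rw [hX]; rfl
  have hrank : Module.finrank ℝ E = Module.finrank ℝ (E →L[ℝ] ℝ) := by
    rw [← LinearMap.toContinuousLinearMap.finrank_eq]
    exact Subspace.dual_finrank_eq.symm
  have : FiniteDimensional ℝ (E →L[ℝ] ℝ) := LinearMap.toContinuousLinearMap.finiteDimensional
  exact ⟨(LinearEquiv.ofInjectiveOfFinrankEq (h : E →ₗ[ℝ] E →L[ℝ] ℝ) hinj
    hrank).toContinuousLinearEquiv, rfl⟩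

section LeviCivita

set_option maxSynthPendingDepth 6

variable {g : E3 → E3 →L[ℝ] E3 →L[ℝ] ℝ} {x : E3}

/-- `g` is a pseudo-Riemannian metric near `x`. -/
structure IsPseudoRiemannianAt (g : E3 → E3 →L[ℝ] E3 →L[ℝ] ℝ) (x : E3) : Prop where
  contDiffAt : ContDiffAt ℝ 2 g x
  eventually_isScalarProduct : ∀ᶠ y in nhds x, IsScalarProduct (g y)

/-- The Christoffel symbols `leviCivita g x` as a continuous bilinear map. -/
def leviCivitaMap (g : E3 → E3 →L[ℝ] E3 →L[ℝ] ℝ) (x : E3) : E3 →L[ℝ] E3 →L[ℝ] E3 :=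
  (ContinuousLinearMap.compL ℝ E3 (E3 →L[ℝ] ℝ) E3 (g x).inverse).comp ((1 / 2 : ℝ) •
    (fderiv ℝ g x + (fderiv ℝ g x).flip -
      (ContinuousLinearMap.flipₗᵢ ℝ E3 E3 ℝ).toContinuousLinearEquiv.toContinuousLinearMap.comp
        (fderiv ℝ g x).flip))

@[simp] theorem leviCivitaMap_apply (X Y : E3) : leviCivitaMap g x X Y = leviCivita g x X Y := rfl

namespace IsPseudoRiemannianAt

theorem isScalarProduct (hg : IsPseudoRiemannianAt g x) : IsScalarProduct (g x) :=
  hg.eventually_isScalarProduct.self_of_nhds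

theorem eventually (hg : IsPseudoRiemannianAt g x) :
    ∀ᶠ y in nhds x, IsPseudoRiemannianAt g y :=
  ((hg.contDiffAt.eventually (by simp)).and hg.eventually_isScalarProduct.eventually_nhds).mono
    fun _ hy => ⟨hy.1, hy.2⟩

theorem differentiableAt (hg : IsPseudoRiemannianAt g x) : DifferentiableAt ℝ g x :=
  hg.contDiffAt.differentiableAt (by simp)

theorem fderiv_symm (hg : IsPseudoRiemannianAt g x) (X Y Z : E3) :
    fderiv ℝ g x X Y Z = fderiv ℝ g x X Z Y := by
  rw [← fderiv_apply_apply hg.differentiableAt, ← fderiv_apply_apply hg.differentiableAt]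
  have symm : (fun y => g y Y Z) =ᶠ[nhds x] fun y => g y Z Y :=
    hg.eventually_isScalarProduct.mono fun y hy => hy.symm Y Z
  rw [symm.fderiv_eq]

theorem apply_leviCivita (hg : IsPseudoRiemannianAt g x) (X Y Z : E3) :
    g x (leviCivita g x X Y) Z
      = (fderiv ℝ g x X Y Z + fderiv ℝ g x Y X Z - fderiv ℝ g x Z X Y) / 2 := by
  rw [leviCivita, hg.isScalarProduct.isInvertible.self_apply_inverse]
  simp only [christoffelFirst, smul_apply, sub_apply, add_apply, ContinuousLinearMap.flip_apply,
    smul_eq_mul]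
  ring

theorem leviCivita_symm (hg : IsPseudoRiemannianAt g x) (X Y : E3) :
    leviCivita g x X Y = leviCivita g x Y X := by
  refine hg.isScalarProduct.isInvertible.injective (ContinuousLinearMap.ext fun Z => ?_)
  rw [hg.apply_leviCivita, hg.apply_leviCivita, hg.fderiv_symm Z X Y]
  ring

theorem areConjugateAt_leviCivita (hg : IsPseudoRiemannianAt g x) :
    AreConjugateAt g (leviCivitaMap g) (leviCivitaMap g) x := by
  intro X Y Z
  rw [leviCivitaMap_apply, leviCivitaMap_apply, hg.isScalarProduct.symm Y, hg.apply_leviCivita,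
    hg.apply_leviCivita, hg.fderiv_symm X Z Y, hg.fderiv_symm Z X Y, hg.fderiv_symm Y X Z]
  ring

theorem differentiableAt_leviCivita (hg : IsPseudoRiemannianAt g x) :
    DifferentiableAt ℝ (leviCivitaMap g) x := by
  have dinv : DifferentiableAt ℝ (fun y => (g y).inverse) x :=
    ((hg.isScalarProduct.isInvertible.contDiffAt_map_inverse (n := 2)).comp x
      hg.contDiffAt).differentiableAt (by simp)
  have dDg : DifferentiableAt ℝ (fderiv ℝ g) x :=
    (hg.contDiffAt.fderiv_right (m := 1) (by norm_num)).differentiableAt (by simp)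
  have dflip : DifferentiableAt ℝ (fun y => (fderiv ℝ g y).flip) x :=
    (ContinuousLinearMap.flipₗᵢ ℝ E3 E3
      (E3 →L[ℝ] ℝ)).toContinuousLinearEquiv.differentiableAt.comp x dDg
  exact ((differentiableAt_const _).clm_apply dinv).clm_comp
    (((dDg.fun_add dflip).fun_sub ((differentiableAt_const _).clm_comp dflip)).fun_const_smul _)

theorem riemann_eq_curvature (hg : IsPseudoRiemannianAt g x) (W X Y : E3) :
    riemann g x W X Y = curvature (leviCivitaMap g) x W X Y := by
  simp only [curvature, ← fderiv_apply_apply hg.differentiableAt_leviCivita]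
  rfl

end IsPseudoRiemannianAt

/-- `(g, Γ)` is a statistical structure: `∇ = D + Γ` is torsion-free and satisfies the Codazzi
equation `(∇_X g)(Y,Z) = (∇_Y g)(X,Z)`, in which the terms `g(∇_X Y, Z) = g(∇_Y X, Z)` have been
cancelled. -/
structure IsStatisticalAt (g : E3 → E3 →L[ℝ] E3 →L[ℝ] ℝ) (Γ : E3 → E3 →L[ℝ] E3 →L[ℝ] E3)
    (x : E3) : Prop where
  torsion_free : ∀ X Y, Γ x X Y = Γ x Y X
  codazzi : ∀ X Y Z,
    fderiv ℝ g x X Y Z - g x Y (Γ x X Z) = fderiv ℝ g x Y X Z - g x X (Γ x Y Z)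

namespace IsStatisticalAt

variable {Γ : E3 → E3 →L[ℝ] E3 →L[ℝ] E3}

theorem areConjugateAt (hg : IsPseudoRiemannianAt g x) (hΓ : IsStatisticalAt g Γ x) :
    AreConjugateAt g Γ (leviCivitaMap g - (Γ - leviCivitaMap g)) x := by
  intro X Y Z
  have codazzi := hΓ.codazzi Z Y X
  have lc := hg.apply_leviCivita X Z Y
  rw [hg.fderiv_symm Z Y X, hg.fderiv_symm Y Z X, hΓ.torsion_free Z, hΓ.torsion_free Y] at codazzi
  rw [hg.fderiv_symm X Z Y, hg.isScalarProduct.symm _ Y] at lc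
  simp only [Pi.sub_apply, sub_apply, map_sub, leviCivitaMap_apply]
  linear_combination -codazzi - 2 * lc + hg.isScalarProduct.symm Z (Γ x X Y)

theorem difference_selfAdjoint (hg : IsPseudoRiemannianAt g x) (hΓ : IsStatisticalAt g Γ x)
    (X Y Z : E3) :
    g x ((Γ - leviCivitaMap g) x X Y) Z = g x Y ((Γ - leviCivitaMap g) x X Z) := by
  have conj := hΓ.areConjugateAt hg X Y Z
  have metric := hg.areConjugateAt_leviCivita X Y Z
  simp only [Pi.sub_apply, sub_apply, map_sub] at conj ⊢
  linear_combination metric - conj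

theorem riemann_add_commutator (hg : IsPseudoRiemannianAt g x) (dΓ : DifferentiableAt ℝ Γ x)
    (hΓ : ∀ᶠ y in nhds x, IsStatisticalAt g Γ y) (W X Y Z : E3) :
    g x (riemann g x W X Y + ((Γ - leviCivitaMap g) x W ((Γ - leviCivitaMap g) x X Y)
        - (Γ - leviCivitaMap g) x X ((Γ - leviCivitaMap g) x W Y))) Z
      = (g x (curvature Γ x W X Y) Z - g x Y (curvature Γ x W X Z)) / 2 := by
  have dA : DifferentiableAt ℝ (Γ - leviCivitaMap g) x := dΓ.sub hg.differentiableAt_leviCivita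
  have average := curvature_add_add_curvature_sub hg.differentiableAt_leviCivita dA W X Y
  have conj := AreConjugateAt.curvature_add_curvature_eq_zero hg.contDiffAt dΓ
    (hg.differentiableAt_leviCivita.sub dA)
    ((hg.eventually.and hΓ).mono fun y hy => hy.2.areConjugateAt hy.1) W X Z Y
  rw [add_sub_cancel] at average
  rw [hg.riemann_eq_curvature]
  have paired := congrArg (fun V => g x V Z) average
  simp only [map_add, map_smul, add_apply, smul_apply, smul_eq_mul] at paired ⊢
  linear_combination (-1 / 2) * paired + (1 / 2) * conj
    + (1 / 2) * hg.isScalarProduct.symm Y (curvature Γ x W X Z)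
    - (1 / 2) * hg.isScalarProduct.symm Z
      (curvature (leviCivitaMap g - (Γ - leviCivitaMap g)) x W X Y)

end IsStatisticalAt

end LeviCivita

theorem sum_smul_coordVec (X : E3) : ∑ i, X i • coordVec i = X := by
  ext j
  fin_cases j <;> simp [coordVec, Fin.sum_univ_three]

theorem trace_eq_sum_coordVec (T : E3 →ₗ[ℝ] E3) :
    LinearMap.trace ℝ E3 T = ∑ i, T (coordVec i) i := by
  rw [LinearMap.trace_eq_matrix_trace ℝ (EuclideanSpace.basisFun (Fin 3) ℝ).toBasis]
  simp [Matrix.trace, LinearMap.toMatrix_apply, coordVec]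

theorem IsScalarProduct.det_gram_coordVec_ne_zero {h : E3 →L[ℝ] E3 →L[ℝ] ℝ}
    (hh : IsScalarProduct h) : (Matrix.of fun i j => h (coordVec i) (coordVec j)).det ≠ 0 := by
  simpa [coordVec] using hh.det_gram_ne_zero (EuclideanSpace.basisFun (Fin 3) ℝ).toBasis

theorem IsPseudoRiemannianAt.hasDerivAt_det_gram {g : E3 → E3 →L[ℝ] E3 →L[ℝ] ℝ} {x : E3}
    (hg : IsPseudoRiemannianAt g x) (X : E3) :
    HasDerivAt (fun t : ℝ => (Matrix.of fun i j => g (x + t • X) (coordVec i) (coordVec j)).det)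
      (2 * (∑ i, leviCivita g x X (coordVec i) i)
        * (Matrix.of fun i j => g x (coordVec i) (coordVec j)).det) 0 := by
  have entry (i j : Fin 3) :
      HasDerivAt (fun t : ℝ => g (x + t • X) (coordVec i) (coordVec j))
        (fderiv ℝ g x X (coordVec i) (coordVec j)) 0 := by
    have dg := hg.differentiableAt
    rw [← fderiv_apply_apply dg]
    have dgij : DifferentiableAt ℝ (fun y => g y (coordVec i) (coordVec j)) x :=
      (dg.clm_apply (differentiableAt_const _)).clm_apply (differentiableAt_const _)
    exact dgij.hasFDerivAt.hasLineDerivAt X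
  have congruence := hasDerivAt_det_of_congruence (t := 0)
    (M := fun t => Matrix.of fun i j => g (x + t • X) (coordVec i) (coordVec j))
    (N := Matrix.of fun i k => leviCivita g x X (coordVec i) k) fun i j => by
      refine (entry i j).congr_deriv ?_
      rw [hg.areConjugateAt_leviCivita, leviCivitaMap_apply, leviCivitaMap_apply]
      conv_lhs =>
        rw [← sum_smul_coordVec (leviCivita g x X (coordVec i)),
          ← sum_smul_coordVec (leviCivita g x X (coordVec j))]
      simp [Matrix.mul_apply, mul_comm]
  simpa [Matrix.trace] using congruence

/-- The matrix whose rows are the coordinate tangent vectors of `f` and the field `ξ`. -/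
def frameMatrix (f ξ : E3 → E4) (x : E3) : Matrix (Fin 4) (Fin 4) ℝ :=
  Matrix.of fun i j => (![fderiv ℝ f x (coordVec 0), fderiv ℝ f x (coordVec 1),
    fderiv ℝ f x (coordVec 2), ξ x] i) j

/-- The matrix `N` for which the Gauss and Weingarten formulas read
`D_X (frameMatrix f ξ) = N * frameMatrix f ξ`. -/
def structureMatrix (f ξ : E3 → E4) (x X : E3) : Matrix (Fin 4) (Fin 4) ℝ :=
  let Γ := fun i => inducedConnection f ξ x X (coordVec i)
  let η := fun i => affineMetric f ξ x X (coordVec i)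
  let S := shapeOperator f ξ x X
  !![Γ 0 0, Γ 0 1, Γ 0 2, η 0; Γ 1 0, Γ 1 1, Γ 1 2, η 1; Γ 2 0, Γ 2 1, Γ 2 2, η 2;
    -S 0, -S 1, -S 2, 0]

/-- `f` is a nondegenerate hypersurface, parametrized by the open set `U`, with affine normal `ξ`;
the local version of `IsBlaschkeHypersurface`. -/
structure IsLocalBlaschkeHypersurface (U : Set E3) (f ξ : E3 → E4) : Prop where
  isOpen : IsOpen U
  smooth : ContDiffOn ℝ ∞ f U
  smooth_normal : ContDiffOn ℝ ∞ ξ U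
  blaschke : ∀ x ∈ U, IsBlaschkeNormalAt f ξ x

/-! ### Structure equations of an affine hypersurface -/

namespace IsLocalBlaschkeHypersurface

set_option maxSynthPendingDepth 6

variable {U : Set E3} {f ξ : E3 → E4} {x : E3}

theorem contDiffAt (hM : IsLocalBlaschkeHypersurface U f ξ) (hx : x ∈ U) : ContDiffAt ℝ ∞ f x :=
  hM.smooth.contDiffAt (hM.isOpen.mem_nhds hx)

theorem contDiffAt_normal (hM : IsLocalBlaschkeHypersurface U f ξ) (hx : x ∈ U) :
    ContDiffAt ℝ ∞ ξ x :=
  hM.smooth_normal.contDiffAt (hM.isOpen.mem_nhds hx)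

theorem differentiableAt_normal (hM : IsLocalBlaschkeHypersurface U f ξ) (hx : x ∈ U) :
    DifferentiableAt ℝ ξ x :=
  (hM.contDiffAt_normal hx).differentiableAt (by simp)

theorem contDiffAt_fderiv (hM : IsLocalBlaschkeHypersurface U f ξ) (hx : x ∈ U) :
    ContDiffAt ℝ ∞ (fderiv ℝ f) x :=
  (hM.contDiffAt hx).fderiv_right (by simp)

theorem differentiableAt_fderiv (hM : IsLocalBlaschkeHypersurface U f ξ) (hx : x ∈ U) :
    DifferentiableAt ℝ (fderiv ℝ f) x :=
  (hM.contDiffAt_fderiv hx).differentiableAt (by simp)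

theorem contDiffAt_hessian (hM : IsLocalBlaschkeHypersurface U f ξ) (hx : x ∈ U) :
    ContDiffAt ℝ ∞ (fderiv ℝ (fderiv ℝ f)) x :=
  (hM.contDiffAt_fderiv hx).fderiv_right (by simp)

theorem isInvertible_frameMap (hM : IsLocalBlaschkeHypersurface U f ξ) (hx : x ∈ U) :
    (frameMap f ξ x).IsInvertible := by
  -- Otherwise the junk value `(frameMap f ξ x).inverse = 0` would make the affine metric vanish.
  by_contra hcon
  have coordVec_eq_zero := (hM.blaschke x hx).nondegenerate (coordVec 0) fun Y => by
    simp [affineMetric, transversalPart, ContinuousLinearMap.inverse_of_not_isInvertible hcon]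
  simp only [coordVec, PiLp.single_eq_zero_iff, one_ne_zero] at coordVec_eq_zero

theorem frameMap_apply (X : E3) (a : ℝ) :
    frameMap f ξ x (X, a) = fderiv ℝ f x X + a • ξ x := by
  simp [frameMap]

theorem frame_injective (hM : IsLocalBlaschkeHypersurface U f ξ) (hx : x ∈ U) {X Y : E3} {a b : ℝ}
    (hXY : fderiv ℝ f x X + a • ξ x = fderiv ℝ f x Y + b • ξ x) : X = Y ∧ a = b := by
  rw [← frameMap_apply, ← frameMap_apply] at hXY
  exact Prod.ext_iff.1 ((hM.isInvertible_frameMap hx).injective hXY)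

theorem decompose (hM : IsLocalBlaschkeHypersurface U f ξ) (hx : x ∈ U) (v : E4) :
    v = fderiv ℝ f x (tangentialPart f ξ x v) + transversalPart f ξ x v • ξ x := by
  rw [← frameMap_apply]
  exact ((hM.isInvertible_frameMap hx).self_apply_inverse v).symm

theorem gauss_formula (hM : IsLocalBlaschkeHypersurface U f ξ) (hx : x ∈ U) (X Y : E3) :
    fderiv ℝ (fderiv ℝ f) x X Y = fderiv ℝ f x (inducedConnection f ξ x X Y)
      + affineMetric f ξ x X Y • ξ x :=
  hM.decompose hx _

theorem weingarten_formula (hM : IsLocalBlaschkeHypersurface U f ξ) (hx : x ∈ U) (X : E3) :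
    fderiv ℝ ξ x X = -fderiv ℝ f x (shapeOperator f ξ x X) := by
  have decomposition := hM.decompose hx (fderiv ℝ ξ x X)
  obtain ⟨Y, hY⟩ := (hM.blaschke x hx).tangential X
  have two_decompositions : fderiv ℝ f x Y + (0 : ℝ) • ξ x
      = fderiv ℝ f x (tangentialPart f ξ x (fderiv ℝ ξ x X))
        + transversalPart f ξ x (fderiv ℝ ξ x X) • ξ x := by
    rw [hY, zero_smul, add_zero, ← decomposition]
  rw [← (hM.frame_injective hx two_decompositions).2, zero_smul, add_zero] at decomposition
  rw [decomposition]
  simp [shapeOperator]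

theorem contDiffAt_inverse_frameMap (hM : IsLocalBlaschkeHypersurface U f ξ) (hx : x ∈ U) :
    ContDiffAt ℝ ∞ (fun y => (frameMap f ξ y).inverse) x := by
  have frameMap_eq : frameMap f ξ = fun y => (fderiv ℝ f y).comp (ContinuousLinearMap.fst ℝ E3 ℝ)
      + (ContinuousLinearMap.snd ℝ E3 ℝ).smulRight (ξ y) := by
    ext y v
    all_goals simp [frameMap]
  have contDiffAt_frameMap : ContDiffAt ℝ ∞ (frameMap f ξ) x := by
    rw [frameMap_eq]
    exact ((hM.contDiffAt_fderiv hx).clm_comp contDiffAt_const).add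
      (contDiffAt_const.smulRight (hM.contDiffAt_normal hx))
  exact ((hM.isInvertible_frameMap hx).contDiffAt_map_inverse (n := ∞)).comp x contDiffAt_frameMap

theorem contDiffAt_inducedConnection (hM : IsLocalBlaschkeHypersurface U f ξ) (hx : x ∈ U) :
    ContDiffAt ℝ ∞ (inducedConnection f ξ) x :=
  (contDiffAt_const.clm_apply
    (contDiffAt_const.clm_comp (hM.contDiffAt_inverse_frameMap hx))).clm_comp
    (hM.contDiffAt_hessian hx)

theorem differentiableAt_inducedConnection (hM : IsLocalBlaschkeHypersurface U f ξ) (hx : x ∈ U) :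
    DifferentiableAt ℝ (inducedConnection f ξ) x :=
  (hM.contDiffAt_inducedConnection hx).differentiableAt (by simp)

theorem contDiffAt_affineMetric (hM : IsLocalBlaschkeHypersurface U f ξ) (hx : x ∈ U) :
    ContDiffAt ℝ ∞ (affineMetric f ξ) x :=
  (contDiffAt_const.clm_apply
    (contDiffAt_const.clm_comp (hM.contDiffAt_inverse_frameMap hx))).clm_comp
    (hM.contDiffAt_hessian hx)

theorem hessian_symm (hM : IsLocalBlaschkeHypersurface U f ξ) (hx : x ∈ U) (X Y : E3) :
    fderiv ℝ (fderiv ℝ f) x X Y = fderiv ℝ (fderiv ℝ f) x Y X :=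
  (hM.contDiffAt hx).isSymmSndFDerivAt (by simpa using ENat.LEInfty.out) X Y

theorem isScalarProduct (hM : IsLocalBlaschkeHypersurface U f ξ) (hx : x ∈ U) :
    IsScalarProduct (affineMetric f ξ x) where
  symm X Y := congrArg (transversalPart f ξ x) (hM.hessian_symm hx X Y)
  nondegenerate := (hM.blaschke x hx).nondegenerate

theorem isPseudoRiemannianAt (hM : IsLocalBlaschkeHypersurface U f ξ) (hx : x ∈ U) :
    IsPseudoRiemannianAt (affineMetric f ξ) x where
  contDiffAt := (hM.contDiffAt_affineMetric hx).of_le ENat.LEInfty.out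
  eventually_isScalarProduct := (hM.isOpen.eventually_mem hx).mono fun _ => hM.isScalarProduct

theorem third_derivative (hM : IsLocalBlaschkeHypersurface U f ξ) (hx : x ∈ U) (X Y Z : E3) :
    fderiv ℝ (fderiv ℝ (fderiv ℝ f)) x Z X Y =
      fderiv ℝ f x (fderiv ℝ (inducedConnection f ξ) x Z X Y
        + inducedConnection f ξ x Z (inducedConnection f ξ x X Y)
        - affineMetric f ξ x X Y • shapeOperator f ξ x Z)
      + (fderiv ℝ (affineMetric f ξ) x Z X Y
        + affineMetric f ξ x Z (inducedConnection f ξ x X Y)) • ξ x := by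
  have dhessian := (hM.contDiffAt_hessian hx).differentiableAt (by simp)
  have df := hM.differentiableAt_fderiv hx
  have dξ := hM.differentiableAt_normal hx
  have dΓ := hM.differentiableAt_inducedConnection hx
  have dh := (hM.isPseudoRiemannianAt hx).differentiableAt
  have gauss : (fun y => fderiv ℝ (fderiv ℝ f) y X Y) =ᶠ[nhds x] fun y =>
      fderiv ℝ f y (inducedConnection f ξ y X Y) + affineMetric f ξ y X Y • ξ y :=
    (hM.isOpen.eventually_mem hx).mono fun y hy => hM.gauss_formula hy X Y
  have dΓXY : DifferentiableAt ℝ (fun y => inducedConnection f ξ y X Y) x := by fun_prop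
  have dhXY : DifferentiableAt ℝ (fun y => affineMetric f ξ y X Y) x := by fun_prop
  have deriv := congrArg (fun A : E3 →L[ℝ] E4 => A Z) gauss.fderiv_eq
  rw [fderiv_apply_apply dhessian, fderiv_fun_add (df.clm_apply dΓXY) (dhXY.fun_smul dξ),
    fderiv_clm_apply df dΓXY, fderiv_fun_smul dhXY dξ] at deriv
  simp only [add_apply, ContinuousLinearMap.comp_apply, ContinuousLinearMap.flip_apply,
    smul_apply, ContinuousLinearMap.smulRight_apply, fderiv_apply_apply dΓ,
    fderiv_apply_apply dh, hM.weingarten_formula hx, hM.gauss_formula hx Z] at deriv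
  rw [deriv]
  simp only [map_add, map_sub, map_smul]
  module

theorem gauss_codazzi (hM : IsLocalBlaschkeHypersurface U f ξ) (hx : x ∈ U) (X Y Z : E3) :
    fderiv ℝ (inducedConnection f ξ) x Z X Y
        + inducedConnection f ξ x Z (inducedConnection f ξ x X Y)
        - affineMetric f ξ x X Y • shapeOperator f ξ x Z
      = fderiv ℝ (inducedConnection f ξ) x X Z Y
        + inducedConnection f ξ x X (inducedConnection f ξ x Z Y)
        - affineMetric f ξ x Z Y • shapeOperator f ξ x X ∧
    fderiv ℝ (affineMetric f ξ) x Z X Y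
        + affineMetric f ξ x Z (inducedConnection f ξ x X Y)
      = fderiv ℝ (affineMetric f ξ) x X Z Y
        + affineMetric f ξ x X (inducedConnection f ξ x Z Y) := by
  refine hM.frame_injective hx ?_
  rw [← hM.third_derivative hx, ← hM.third_derivative hx]
  exact congrArg (fun A : E3 →L[ℝ] E4 => A Y)
    ((hM.contDiffAt_fderiv hx).isSymmSndFDerivAt (by simpa using ENat.LEInfty.out) Z X)

theorem curvature_inducedConnection (hM : IsLocalBlaschkeHypersurface U f ξ) (hx : x ∈ U)
    (W X Y : E3) :
    curvature (inducedConnection f ξ) x W X Y = affineMetric f ξ x X Y • shapeOperator f ξ x W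
      - affineMetric f ξ x W Y • shapeOperator f ξ x X := by
  rw [curvature]
  linear_combination (norm := module) (hM.gauss_codazzi hx X Y W).1

theorem isStatisticalAt (hM : IsLocalBlaschkeHypersurface U f ξ) (hx : x ∈ U) :
    IsStatisticalAt (affineMetric f ξ) (inducedConnection f ξ) x where
  torsion_free X Y := congrArg (tangentialPart f ξ x) (hM.hessian_symm hx X Y)
  codazzi X Y Z := by linear_combination (hM.gauss_codazzi hx Y Z X).2

theorem differenceTensor_symm (hM : IsLocalBlaschkeHypersurface U f ξ) (hx : x ∈ U) (X Y : E3) :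
    differenceTensor f ξ x X Y = differenceTensor f ξ x Y X := by
  rw [differenceTensor, differenceTensor, (hM.isStatisticalAt hx).torsion_free X,
    (hM.isPseudoRiemannianAt hx).leviCivita_symm X]

theorem differenceTensor_selfAdjoint (hM : IsLocalBlaschkeHypersurface U f ξ) (hx : x ∈ U)
    (X Y Z : E3) :
    affineMetric f ξ x (differenceTensor f ξ x X Y) Z
      = affineMetric f ξ x Y (differenceTensor f ξ x X Z) :=
  (hM.isStatisticalAt hx).difference_selfAdjoint (hM.isPseudoRiemannianAt hx) X Y Z

theorem hasDerivAt_frameMatrix (hM : IsLocalBlaschkeHypersurface U f ξ) (hx : x ∈ U) (X : E3)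
    (i j : Fin 4) :
    HasDerivAt (fun t : ℝ => frameMatrix f ξ (x + t • X) i j)
      ((structureMatrix f ξ x X * frameMatrix f ξ x) i j) 0 := by
  have coordinates (V : E3) : fderiv ℝ f x V = ∑ k, V k • fderiv ℝ f x (coordVec k) := by
    conv_lhs => rw [← sum_smul_coordVec V]
    simp only [map_sum, map_smul]
  have tangent (k : Fin 3) : HasDerivAt (fun t : ℝ => fderiv ℝ f (x + t • X) (coordVec k) j)
      (fderiv ℝ (fderiv ℝ f) x X (coordVec k) j) 0 := by
    have line := (hM.differentiableAt_fderiv hx).hasFDerivAt.hasLineDerivAt X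
    exact (EuclideanSpace.proj (𝕜 := ℝ) j).hasFDerivAt.comp_hasDerivAt 0
      (HasDerivAt.clm_apply line (hasDerivAt_const _ _) |>.congr_deriv (by simp))
  have normal : HasDerivAt (fun t : ℝ => ξ (x + t • X) j) (fderiv ℝ ξ x X j) 0 :=
    (EuclideanSpace.proj (𝕜 := ℝ) j).hasFDerivAt.comp_hasDerivAt 0
      ((hM.differentiableAt_normal hx).hasFDerivAt.hasLineDerivAt X)
  have structure_eq : (structureMatrix f ξ x X * frameMatrix f ξ x) i j =
      (![fderiv ℝ (fderiv ℝ f) x X (coordVec 0), fderiv ℝ (fderiv ℝ f) x X (coordVec 1),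
        fderiv ℝ (fderiv ℝ f) x X (coordVec 2), fderiv ℝ ξ x X] i) j := by
    rw [hM.weingarten_formula hx, hM.gauss_formula hx, hM.gauss_formula hx, hM.gauss_formula hx,
      coordinates (shapeOperator f ξ x X), coordinates (inducedConnection f ξ x X (coordVec 0)),
      coordinates (inducedConnection f ξ x X (coordVec 1)),
      coordinates (inducedConnection f ξ x X (coordVec 2))]
    fin_cases i <;>
      simp [Matrix.mul_apply, Fin.sum_univ_four, Fin.sum_univ_three, structureMatrix, frameMatrix]
    ring
  rw [structure_eq]
  fin_cases i
  exacts [tangent 0, tangent 1, tangent 2, normal]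

theorem hasDerivAt_det_frameMatrix (hM : IsLocalBlaschkeHypersurface U f ξ) (hx : x ∈ U)
    (X : E3) :
    HasDerivAt (fun t : ℝ => (frameMatrix f ξ (x + t • X)).det)
      ((∑ i, inducedConnection f ξ x X (coordVec i) i) * (frameMatrix f ξ x).det) 0 := by
  have trace_eq : (structureMatrix f ξ x X).trace
      = ∑ i, inducedConnection f ξ x X (coordVec i) i := by
    simp [Matrix.trace, Fin.sum_univ_four, Fin.sum_univ_three, structureMatrix]
  have deriv := hasDerivAt_det_of_mul_left (t := 0) (M := fun t => frameMatrix f ξ (x + t • X))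
    (N := structureMatrix f ξ x X) fun i j => by
      simpa only [zero_smul, add_zero] using hM.hasDerivAt_frameMatrix hx X i j
  simpa only [trace_eq, zero_smul, add_zero] using deriv

theorem det_frameMatrix_pow_four (hM : IsLocalBlaschkeHypersurface U f ξ) (hx : x ∈ U) :
    (frameMatrix f ξ x).det ^ 4
      = (Matrix.of fun i j => affineMetric f ξ x (coordVec i) (coordVec j)).det ^ 2 := by
  have volume : (frameMatrix f ξ x).det ^ 2
      = |(Matrix.of fun i j => affineMetric f ξ x (coordVec i) (coordVec j)).det| :=
    (hM.blaschke x hx).volume coordVec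
  rw [← sq_abs (Matrix.det (Matrix.of _)), ← volume, ← pow_mul]

-- Apolarity: differentiate `det (frameMatrix f ξ) ^ 4 = det h ^ 2` along `X`.
theorem trace_differenceTensor (hM : IsLocalBlaschkeHypersurface U f ξ) (hx : x ∈ U) (X : E3) :
    ∑ i, differenceTensor f ξ x X (coordVec i) i = 0 := by
  have frame_deriv := (hM.hasDerivAt_det_frameMatrix hx X).pow 4
  have gram_deriv := ((hM.isPseudoRiemannianAt hx).hasDerivAt_det_gram X).pow 2
  have line_tendsto : Filter.Tendsto (fun t : ℝ => x + t • X) (nhds 0) (nhds x) := by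
    have : Continuous fun t : ℝ => x + t • X := by fun_prop
    simpa using this.tendsto 0
  have eventually_eq := line_tendsto.eventually <|
    (hM.isOpen.eventually_mem hx).mono fun _ => hM.det_frameMatrix_pow_four
  have deriv_eq := frame_deriv.unique (gram_deriv.congr_of_eventuallyEq eventually_eq)
  have volume_eq := hM.det_frameMatrix_pow_four hx
  have gram_ne_zero := pow_ne_zero 2 (hM.isScalarProduct hx).det_gram_coordVec_ne_zero
  simp only [differenceTensor, PiLp.sub_apply, Finset.sum_sub_distrib]
  refine (mul_eq_zero.1 ?_).resolve_left gram_ne_zero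
  simp only [zero_smul, add_zero] at deriv_eq
  linear_combination deriv_eq / 4
    - (∑ i, inducedConnection f ξ x X (coordVec i) i) * volume_eq

theorem isTracelessCubic (hM : IsLocalBlaschkeHypersurface U f ξ) (hx : x ∈ U) :
    IsTracelessCubic (affineMetric f ξ x)
      (inducedConnection f ξ x - leviCivitaMap (affineMetric f ξ) x).toLinearMap₁₂ where
  symm X Y := hM.differenceTensor_symm hx X Y
  symm' X Y Z := (hM.differenceTensor_selfAdjoint hx X Y Z).trans ((hM.isScalarProduct hx).symm _ _)
  trace X := (trace_eq_sum_coordVec _).trans (hM.trace_differenceTensor hx X)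

theorem riemann_eq (hM : IsLocalBlaschkeHypersurface U f ξ) (hx : x ∈ U) {H : ℝ}
    (hS : ∀ X, shapeOperator f ξ x X = H • X) (W X Y : E3) :
    riemann (affineMetric f ξ) x W X Y
      = (H * affineMetric f ξ x X Y) • W - (H * affineMetric f ξ x W Y) • X
        - (differenceTensor f ξ x W (differenceTensor f ξ x X Y)
          - differenceTensor f ξ x X (differenceTensor f ξ x W Y)) := by
  have hg := hM.isPseudoRiemannianAt hx
  rw [eq_sub_iff_add_eq]
  refine hg.isScalarProduct.isInvertible.injective (ContinuousLinearMap.ext fun Z => ?_)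
  refine (IsStatisticalAt.riemann_add_commutator hg (hM.differentiableAt_inducedConnection hx)
    ((hM.isOpen.eventually_mem hx).mono fun _ => hM.isStatisticalAt) W X Y Z).trans ?_
  simp only [hM.curvature_inducedConnection hx, hS, map_sub, map_smul, sub_apply, smul_apply,
    smul_eq_mul, hg.isScalarProduct.symm Y]
  ring

end IsLocalBlaschkeHypersurface

/-! ### Constant curvature -/

section ConstantCurvature

variable {g : E3 → E3 →L[ℝ] E3 →L[ℝ] ℝ} {x : E3} {H : ℝ}

theorem IsScalarProduct.sum_inverseMetric_mul (hg : IsScalarProduct (g x)) :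
    ∑ i, ∑ j, inverseMetric g x i j * g x (coordVec i) (coordVec j) = 3 := by
  have trace_one := congrArg Matrix.trace
    (Matrix.nonsing_inv_mul _ hg.det_gram_coordVec_ne_zero.isUnit)
  simpa [Matrix.trace, Matrix.mul_apply, inverseMetric, hg.symm (coordVec _) (coordVec _)]
    using trace_one

/-- `g` has constant sectional curvature `H` at `x`, as an identity for the curvature tensor. -/
def HasConstantCurvatureAt (g : E3 → E3 →L[ℝ] E3 →L[ℝ] ℝ) (x : E3) (H : ℝ) : Prop :=
  ∀ W X Y, riemann g x W X Y = (H * g x X Y) • W - (H * g x W Y) • X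

namespace HasConstantCurvatureAt

theorem sectionalCurvature_eq (hR : HasConstantCurvatureAt g x H) (hg : IsScalarProduct (g x))
    {X Y : E3} (hXY : planeForm g x X Y ≠ 0) : sectionalCurvature g x X Y = H := by
  rw [sectionalCurvature, div_eq_iff hXY, hR, planeForm]
  simp only [map_sub, map_smul, sub_apply, smul_apply, smul_eq_mul, hg.symm Y X]
  ring

theorem ricci_eq (hR : HasConstantCurvatureAt g x H) (X Y : E3) :
    ricci g x X Y = 2 * H * g x X Y := by
  have coordinates : ∑ i, X i * g x (coordVec i) Y = g x X Y := by
    conv_rhs => rw [← sum_smul_coordVec X]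
    simp
  have diagonal (i : Fin 3) : coordVec i i = 1 := by simp [coordVec]
  simp only [ricci, hR _ _ _, PiLp.sub_apply, PiLp.smul_apply, smul_eq_mul, diagonal, mul_one,
    Finset.sum_sub_distrib, Finset.sum_const, Finset.card_univ, Fintype.card_fin, nsmul_eq_mul]
  rw [← coordinates, Finset.mul_sum, Finset.mul_sum, Finset.mul_sum, ← Finset.sum_sub_distrib]
  refine Finset.sum_congr rfl fun i _ => ?_
  push_cast
  ring

theorem scalarCurvature_eq (hR : HasConstantCurvatureAt g x H) (hg : IsScalarProduct (g x)) :
    scalarCurvature g x = H := by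
  simp only [scalarCurvature, hR.ricci_eq, mul_left_comm _ (2 * H), ← Finset.mul_sum]
  rw [hg.sum_inverseMetric_mul]
  ring

end HasConstantCurvatureAt

end ConstantCurvature

namespace IsLocalBlaschkeHypersurface

variable {U : Set E3} {f ξ : E3 → E4} {x : E3} {G : Type*} [Group G] [Nontrivial G]
  [IsMulTorsionFree G]

theorem exists_isotropic_differenceTensor_eq (hM : IsLocalBlaschkeHypersurface U f ξ)
    (hx : x ∈ U) (hsym : HasSymmetryAt G f ξ x) :
    ∃ (e : E3) (c : ℝ), affineMetric f ξ x e e = 0 ∧ ∀ X Y, differenceTensor f ξ x X Y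
      = (c * affineMetric f ξ x e X * affineMetric f ξ x e Y) • e := by
  obtain ⟨C, hC, ⟨φ⟩, preserves⟩ := hsym
  have := Function.Injective.isMulTorsionFree φ.symm.toMonoidHom φ.symm.injective
  have := φ.symm.toEquiv.nontrivial
  exact exists_isotropic_eq_smul (hM.isScalarProduct hx) hC (hM.isTracelessCubic hx)
    fun L hL => (preserves L hL).1

theorem hasConstantCurvatureAt (hM : IsLocalBlaschkeHypersurface U f ξ) (hx : x ∈ U)
    (hsym : HasSymmetryAt G f ξ x) {H : ℝ} (hS : ∀ X, shapeOperator f ξ x X = H • X) :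
    HasConstantCurvatureAt (affineMetric f ξ) x H := fun W X Y => by
  obtain ⟨e, c, isotropic, hK⟩ := hM.exists_isotropic_differenceTensor_eq hx hsym
  have commute : differenceTensor f ξ x W (differenceTensor f ξ x X Y)
      = differenceTensor f ξ x X (differenceTensor f ξ x W Y) := by
    simp [hK, isotropic]
  rw [hM.riemann_eq hx hS, commute, sub_self, sub_zero]

theorem pickInvariant_eq_zero (hM : IsLocalBlaschkeHypersurface U f ξ) (hx : x ∈ U)
    (hsym : HasSymmetryAt G f ξ x) : pickInvariant f ξ x = 0 := by
  obtain ⟨e, c, isotropic, hK⟩ := hM.exists_isotropic_differenceTensor_eq hx hsym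
  simp [pickInvariant, hK, isotropic]

end IsLocalBlaschkeHypersurface

theorem IsBlaschkeHypersurface.isLocalBlaschkeHypersurface {M : Type*} [TopologicalSpace M]
    [ChartedSpace E3 M] [IsManifold (𝓡 3) ∞ M] {φ ξ : M → E4} (hM : IsBlaschkeHypersurface φ ξ)
    {e : OpenPartialHomeomorph M E3} (he : e ∈ IsManifold.maximalAtlas (𝓡 3) ∞ M) :
    IsLocalBlaschkeHypersurface e.target (φ ∘ e.symm) (ξ ∘ e.symm) where
  isOpen := e.open_target
  smooth := (hM.smooth.comp_contMDiffOn (contMDiffOn_symm_of_mem_maximalAtlas he)).contDiffOn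
  smooth_normal :=
    (hM.smooth_normal.comp_contMDiffOn (contMDiffOn_symm_of_mem_maximalAtlas he)).contDiffOn
  blaschke := hM.blaschke e he

end AffineGeometry

end

open AffineGeometry in
theorem theorem6p1_general {M : Type*} [TopologicalSpace M] [ChartedSpace E3 M]
    [IsManifold (𝓡 3) ∞ M] {G : Type*} [Group G] [Nontrivial G] [IsMulTorsionFree G]
    (φ ξ : M → E4) (H : ℝ) (hM : IsAffineHypersphere φ ξ H)
    (hsym : AdmitsPointwiseSymmetry G φ ξ) :
    HasConstantSectionalCurvature φ ξ H ∧
    Everywhere φ ξ (fun f ξ x => scalarCurvature (affineMetric f ξ) x = H) ∧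
    Everywhere φ ξ (fun f ξ x => pickInvariant f ξ x = 0) := by
  have local_structure {e : OpenPartialHomeomorph M E3}
      (he : e ∈ IsManifold.maximalAtlas (𝓡 3) ∞ M) :=
    hM.isLocalBlaschkeHypersurface he
  refine ⟨fun e he x hx X Y => ?_, fun e he x hx => ?_, fun e he x hx => ?_⟩
  · exact ((local_structure he).hasConstantCurvatureAt hx (hsym e he x hx)
      (hM.shape e he x hx)).sectionalCurvature_eq ((local_structure he).isScalarProduct hx)
  · exact ((local_structure he).hasConstantCurvatureAt hx (hsym e he x hx)
      (hM.shape e he x hx)).scalarCurvature_eq ((local_structure he).isScalarProduct hx)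
  · exact (local_structure he).pickInvariant_eq_zero hx (hsym e he x hx)

/-- A 3-dimensional indefinite affine hypersphere admitting a pointwise `ℝ`-symmetry has constant
sectional curvature `H`, normalized scalar curvature `H`, and vanishing Pick invariant. -/
theorem theorem6p1 {M : Type*} [TopologicalSpace M] [ChartedSpace AffineGeometry.E3 M]
    [IsManifold (𝓡 3) ∞ M] (φ ξ : M → AffineGeometry.E4) (H : ℝ)
    (hM : AffineGeometry.IsAffineHypersphere φ ξ H)
    (hind : AffineGeometry.IsIndefinite φ ξ)
    (hsym : AffineGeometry.AdmitsPointwiseSymmetry (Multiplicative ℝ) φ ξ) :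
    AffineGeometry.HasConstantSectionalCurvature φ ξ H ∧
    AffineGeometry.Everywhere φ ξ (fun f ξ x =>
      AffineGeometry.scalarCurvature (AffineGeometry.affineMetric f ξ) x = H) ∧
    AffineGeometry.Everywhere φ ξ (fun f ξ x => AffineGeometry.pickInvariant f ξ x = 0) :=
  theorem6p1_general φ ξ H hM hsym
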